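/- Let $\rho = 1+\sqrt2$, let $\nu(i)$ denote the largest integer $j$ with $2^j \mid i$, and for $M>0$ let $\alpha_t = (\rho^{\nu(t+1)-1}+1)/M$ for $t \ge 0$ (the silver stepsize schedule). Let $f:\mathbb R^d\to\mathbb R$ be convex and differentiable with $M$-Lipschitz gradient (Euclidean norm), let $h:\mathbb R^d\to\mathbb R\cup\{+\infty\}$ be convex and not identically $+\infty$, let $F=f+h$, and let $x_*$ be any minimizer of $F$. Let $n = 2^k-1$ with $k\ge 1$, and let $x_0,\dots,x_n\in\mathbb R^d$ be the iterates of proximal gradient descent from an arbitrary $x_0$, i.e. $x_{t+1}\in\operatorname{argmin}_z\, \{h(z)+\tfrac1{2\alpha_t}\|z-(x_t-\alpha_t\nabla f(x_t))\|^2\}$ for $0\le t<n$. Then $$F(x_n)-F(x_*)\le \frac{\rho}{4\sqrt2\, n^{\log_2\rho}}\, M\|x_0-x_*\|^2 .$$ In particular, there is an absolute constant $C>0$ such that for all $M>0$, $D\ge 0$ and $\varepsilon>0$ there is a number of iterations $n=2^k-1$, $k\ge1$, with $$n\le \max\bigl\{1,\; C\,(MD^2/\varepsilon)^{\log_\rho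 2}\bigr\}$$ for which $F(x_n)-F(x_*)\le\varepsilon$ holds for every $d,f,h,x_0,x_*$ as above with $\|x_0-x_*\|\le D$. Both conclusions hold in the following special cases. (a) Projected gradient descent: $x_{t+1}$ is a nearest point to $x_t-\alpha_t\nabla f(x_t)$ in a convex set $K\subseteq\mathbb R^d$, $x_*$ is a minimizer of $f$ over $K$, and $F(x_n)-F(x_*)$ is replaced by $f(x_n)-f(x_*)$. (b) ISTA: $F=f+\lambda\|\cdot\|_1$ with $\lambda\ge0$, $x_*$ is a minimizer of $F$, and $x_{t+1}$ is obtained from $y=x_t-\alpha_t\nabla f(x_t)$ by coordinatewise soft thresholding, $(x_{t+1})_i=\operatorname{sign}(y_i)\max(|y_i|-\alpha_t\lambda,0)$. -/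

import Mathlib

open Set

noncomputable section

/-- The silver ratio `1 + √2`. -/
def silverRatio : ℝ := 1 + √2

/-- The silver stepsize schedule for an `M`-smooth objective:
`α_t = (ρ ^ (ν(t + 1) - 1) + 1) / M`, where `ν` is the `2`-adic valuation; the exponent is an
integer and equals `-1` when `t` is even. -/
def silverStep (M : ℝ) (t : ℕ) : ℝ :=
  (silverRatio ^ ((padicValNat 2 (t + 1) : ℤ) - 1) + 1) / M

section Composite

variable {E : Type*} [NormedAddCommGroup E] [InnerProductSpace ℝ E] [CompleteSpace E]

/-- `f` is convex and `M`-smooth: it is differentiable with `M`-Lipschitz gradient. -/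
structure IsSmoothConvex (M : ℝ) (f : E → ℝ) : Prop where
  convex : ConvexOn ℝ univ f
  differentiable : Differentiable ℝ f
  lipschitz : ∀ x y : E, ‖gradient f x - gradient f y‖ ≤ M * ‖x - y‖

/-- `h` is a proper convex extended-real-valued function: its epigraph is convex, it never takes
the value `-∞`, and it is not identically `+∞`. -/
structure IsProperConvex (h : E → EReal) : Prop where
  convex_epigraph : Convex ℝ {p : E × ℝ | h p.1 ≤ (p.2 : EReal)}
  ne_bot : ∀ x, h x ≠ ⊥
  exists_ne_top : ∃ x, h x ≠ ⊤

/-- `z` is the value at `y` of the proximal operator of `a h`, i.e.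
`z ∈ argmin_w h(w) + ‖w - y‖² / (2 a)`. -/
def IsProx (a : ℝ) (h : E → EReal) (y z : E) : Prop :=
  IsMinOn (fun w => h w + ((1 / (2 * a) * ‖w - y‖ ^ 2 : ℝ) : EReal)) univ z

/-- `x 0, …, x n` are the iterates of `n` steps of proximal gradient descent on `f + h` with
stepsizes `α`. -/
def IsProxGD (f : E → ℝ) (h : E → EReal) (α : ℕ → ℝ) (n : ℕ) (x : ℕ → E) : Prop :=
  ∀ t < n, IsProx (α t) h (x t - α t • gradient f (x t)) (x (t + 1))

/-- The composite objective `F = f + h`. -/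
def objective (f : E → ℝ) (h : E → EReal) (x : E) : EReal := (f x : EReal) + h x

/-- `x 0, …, x n` are the iterates of `n` steps of projected gradient descent for minimizing `f`
over `K`: each new iterate is a nearest point of `K`. -/
def IsProjGD (f : E → ℝ) (K : Set E) (α : ℕ → ℝ) (n : ℕ) (x : ℕ → E) : Prop :=
  ∀ t < n, x (t + 1) ∈ K ∧ IsMinOn (fun w => ‖w - (x t - α t • gradient f (x t))‖) K (x (t + 1))

/-- An instance of composite minimization with a run of `n` steps of proximal gradient descent
with the silver stepsize schedule, and a minimizer `xs` of `F = f + h`. -/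
structure SilverProxGD (M : ℝ) (f : E → ℝ) (h : E → EReal) (n : ℕ) (x : ℕ → E) (xs : E) :
    Prop where
  pos : 0 < M
  smooth : IsSmoothConvex M f
  proper : IsProperConvex h
  run : IsProxGD f h (silverStep M) n x
  minimizer : IsMinOn (objective f h) univ xs

/-- An instance of constrained minimization with a run of `n` steps of projected gradient descent
with the silver stepsize schedule, and a minimizer `xs` of `f` over the convex set `K`. -/
structure SilverProjGD (M : ℝ) (f : E → ℝ) (K : Set E) (n : ℕ) (x : ℕ → E) (xs : E) :
    Prop where
  pos : 0 < M
  smooth : IsSmoothConvex M f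
  convex : Convex ℝ K
  run : IsProjGD f K (silverStep M) n x
  mem : xs ∈ K
  minimizer : IsMinOn f K xs

end Composite

section ISTA

variable {d : ℕ}

/-- The `ℓ¹` norm on `ℝ^d`. -/
def l1Norm (x : EuclideanSpace ℝ (Fin d)) : ℝ := ∑ i, |x i|

/-- Coordinatewise soft thresholding at level `a`. -/
def softThreshold (a : ℝ) (y : EuclideanSpace ℝ (Fin d)) : EuclideanSpace ℝ (Fin d) :=
  WithLp.toLp 2 fun i => Real.sign (y i) * max (|y i| - a) 0

/-- `x 0, …, x n` are the iterates of `n` steps of the iterative soft-thresholding algorithm for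
`f + l ‖·‖₁` with stepsizes `α`. -/
def IsISTA (f : EuclideanSpace ℝ (Fin d) → ℝ) (l : ℝ) (α : ℕ → ℝ) (n : ℕ)
    (x : ℕ → EuclideanSpace ℝ (Fin d)) : Prop :=
  ∀ t < n, x (t + 1) = softThreshold (α t * l) (x t - α t • gradient f (x t))

/-- An instance of `ℓ¹`-regularized minimization with a run of `n` steps of ISTA with the silver
stepsize schedule, and a minimizer `xs` of `f + l ‖·‖₁`. -/
structure SilverISTA (M : ℝ) (f : EuclideanSpace ℝ (Fin d) → ℝ) (l : ℝ) (n : ℕ)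
    (x : ℕ → EuclideanSpace ℝ (Fin d)) (xs : EuclideanSpace ℝ (Fin d)) : Prop where
  pos : 0 < M
  smooth : IsSmoothConvex M f
  nonneg : 0 ≤ l
  run : IsISTA f l (silverStep M) n x
  minimizer : IsMinOn (fun w => f w + l * l1Norm w) univ xs

end ISTA

/-- The error bound `ρ / (4 √2 n ^ (log₂ ρ)) * M * D²`. -/
def silverRate (M D : ℝ) (n : ℕ) : ℝ :=
  silverRatio / (4 * √2 * (n : ℝ) ^ Real.logb 2 silverRatio) * (M * D ^ 2)

end

/-!
The proof is by duality: at each horizon `2 ^ k - 1` the bound on the final objective gap is a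
nonnegative combination of the interpolation inequalities of `f`, the subgradient inequalities of
`h` and squares of norms, and these combinations are built recursively from `k` to `k + 1`.

A proximal step is an implicit subgradient step
`x (t + 1) = x t - α t • (∇f (x t) + s (t + 1))` with
`s (t + 1)` a subgradient of `h` at `x (t + 1)`; the same holds for nearest points (`h` is zero on
`K`) and for soft thresholding, so the three algorithms are treated together
(`rate_of_subgradientRun`). Dividing by `M` and moving the linear form `⟪∇f(xs), ·⟫` from `f` to
`h`, one may assume that `M = 1` and that the gradient of `f` vanishes at the comparison point.
After this only `xs ∈ dom h` is used: the estimate compares `F (x n)` with `F p` for every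
`p ∈ dom h`.

Write `ρ = 1 + √2` and `r = ρ ^ k`. The schedule of length `2 ^ (k + 1) - 1` consists of two blocks
with the schedule of length `2 ^ k - 1`, separated by a step of size `1 + r / ρ`. Two kinds of
estimates are propagated. `SilverBlock` concerns a block from `u` to `v` that starts inside `dom h`.
It bounds `r (r - 1) ‖∇f(v) + w‖²`, together with the gap `h v - ⟪w, v⟫ - cw` of an affine minorant
of `h` with slope `w`, by `‖u‖² - ‖v‖²` and function values, and it retains, in aggregated form, the
minorants of `f` and `h` generated inside the block, so that they can be tested at later points.
`SilverBlock.glue` combines two blocks; the weights are those of the exact identity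
`block_identity`, and Jensen's inequality merges the slopes. The initial point need not
lie in `dom h`, so the first block is treated apart: `SilverStart` is an estimate relative to `p`,
with `M_k ‖∇f(v) + w‖²` in place of `r (r - 1) ‖∇f(v) + w‖²`. The choice
`M_k = r ^ 2 (1 - 13 / (10 ρ))` is reproduced by the recursion (`start_identity`,
`SilverStart.glue`, `SilverStart.succ`), and the case of three steps is an explicit sum of squares
(`start_base_identity`). The loss in `M_k` is harmless, since `SilverStart.estimate` only needs
`M_k ≥ b ^ 2` and `M_k ≥ b (1 + r / ρ)` with `b = 1 + r / ρ ^ 2`, and it yields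
`4 √2 ρ ^ (k - 1) (F (x n) - F p) ≤ ‖x 0 - p‖²`; for `k = 1` this is `one_step_estimate`. The stated
rate follows from `n ≤ 2 ^ k`.
-/

/-! ### Minorants and blocks of steps -/

section Blocks

variable {E : Type*} [NormedAddCommGroup E] [InnerProductSpace ℝ E]

local notation "⟪" x ", " y "⟫" => inner ℝ x y

/-- The interpolation inequality of a convex `1`-smooth function `f` with gradient `g`. -/
def IsCocoercive (f : E → ℝ) (g : E → E) : Prop :=
  ∀ x y, f y + ⟪g y, x - y⟫ + 1 / 2 * ‖g x - g y‖ ^ 2 ≤ f x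

/-- `⟪a, ·⟫ + c` is a minorant of mass `m` for the smooth part: for a nonnegative combination of
total mass `m` of the interpolation inequalities at points `y`, viewed as lower bounds for
`f z - ‖g z‖² / 2` that are affine in `z - g z`. -/
def IsSmoothMinorant (f : E → ℝ) (g : E → E) (m : ℝ) (a : E) (c : ℝ) : Prop :=
  ∀ z, ⟪a, z - g z⟫ + c ≤ m * (f z - 1 / 2 * ‖g z‖ ^ 2)

/-- `⟪a, ·⟫ + c` is an affine minorant of `m • h` on `K`. -/
def IsAffineMinorant (h : E → ℝ) (K : Set E) (m : ℝ) (a : E) (c : ℝ) : Prop :=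
  ∀ z ∈ K, ⟪a, z⟫ + c ≤ m * h z

/-- `s` is a subgradient at `x` of `h` restricted to `K`. -/
def IsSubgradientOn (h : E → ℝ) (K : Set E) (x s : E) : Prop :=
  ∀ z ∈ K, h x + ⟪s, z - x⟫ ≤ h z

theorem IsCocoercive.isSmoothMinorant {f : E → ℝ} {g : E → E} (hf : IsCocoercive f g) (x : E) :
    IsSmoothMinorant f g 1 (g x) (f x + 1 / 2 * ‖g x‖ ^ 2 - ⟪g x, x⟫) := by
  intro z
  have h := hf z x
  simp only [norm_sub_sq_real, inner_sub_right] at h ⊢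
  rw [real_inner_comm (g x) (g z)] at h
  linarith

theorem IsSubgradientOn.isAffineMinorant {h : E → ℝ} {K : Set E} {x s : E}
    (hs : IsSubgradientOn h K x s) : IsAffineMinorant h K 1 s (h x - ⟪s, x⟫) := by
  intro z hz
  have := hs z hz
  rw [inner_sub_right] at this
  linarith

theorem IsSmoothMinorant.add {f : E → ℝ} {g : E → E} {m n : ℝ} {a b : E} {c d : ℝ}
    (h₁ : IsSmoothMinorant f g m a c) (h₂ : IsSmoothMinorant f g n b d) :
    IsSmoothMinorant f g (m + n) (a + b) (c + d) := by
  intro z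
  have := add_le_add (h₁ z) (h₂ z)
  rw [inner_add_left]
  linarith

theorem IsSmoothMinorant.smul {f : E → ℝ} {g : E → E} {m : ℝ} {a : E} {c : ℝ}
    (h : IsSmoothMinorant f g m a c) {t : ℝ} (ht : 0 ≤ t) :
    IsSmoothMinorant f g (t * m) (t • a) (t * c) := by
  intro z
  have := mul_le_mul_of_nonneg_left (h z) ht
  rw [real_inner_smul_left]
  linarith

theorem IsAffineMinorant.add {h : E → ℝ} {K : Set E} {m n : ℝ} {a b : E} {c d : ℝ}
    (h₁ : IsAffineMinorant h K m a c) (h₂ : IsAffineMinorant h K n b d) :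
    IsAffineMinorant h K (m + n) (a + b) (c + d) := by
  intro z hz
  have := add_le_add (h₁ z hz) (h₂ z hz)
  rw [inner_add_left]
  linarith

theorem IsAffineMinorant.smul {h : E → ℝ} {K : Set E} {m : ℝ} {a : E} {c : ℝ}
    (hm : IsAffineMinorant h K m a c) {t : ℝ} (ht : 0 ≤ t) :
    IsAffineMinorant h K (t * m) (t • a) (t * c) := by
  intro z hz
  have := mul_le_mul_of_nonneg_left (hm z hz) ht
  rw [real_inner_smul_left]
  linarith

/-- Jensen's inequality for `‖q + ·‖²` with three weights of total mass `m`. -/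
theorem mul_norm_add_sq_le {a b c m : ℝ} (ha : 0 ≤ a) (hb : 0 ≤ b) (hc : 0 ≤ c) (hm : 0 < m)
    (hsum : a + b + c = m) (q x y z : E) :
    m * ‖q + m⁻¹ • (a • x + b • y + c • z)‖ ^ 2 ≤
      a * ‖q + x‖ ^ 2 + b * ‖q + y‖ ^ 2 + c * ‖q + z‖ ^ 2 := by
  have key : m * (a * ‖q + x‖ ^ 2 + b * ‖q + y‖ ^ 2 + c * ‖q + z‖ ^ 2) =
      m ^ 2 * ‖q + m⁻¹ • (a • x + b • y + c • z)‖ ^ 2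
        + (a * b * ‖x - y‖ ^ 2 + a * c * ‖x - z‖ ^ 2 + b * c * ‖y - z‖ ^ 2) := by
    have h1 : m ^ 2 * ‖q + m⁻¹ • (a • x + b • y + c • z)‖ ^ 2 =
        ‖m • q + (a • x + b • y + c • z)‖ ^ 2 := by
      rw [← sq_abs m, ← Real.norm_eq_abs, ← mul_pow, ← norm_smul, smul_add,
        smul_inv_smul₀ hm.ne']
    rw [h1, ← hsum]
    simp only [← real_inner_self_eq_norm_sq, inner_add_left, inner_add_right, inner_sub_left,
      inner_sub_right, real_inner_smul_left, real_inner_smul_right, real_inner_comm q x,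
      real_inner_comm q y, real_inner_comm q z, real_inner_comm x y, real_inner_comm x z,
      real_inner_comm y z]
    ring
  have h3 : 0 ≤ a * b * ‖x - y‖ ^ 2 + a * c * ‖x - z‖ ^ 2 + b * c * ‖y - z‖ ^ 2 := by positivity
  nlinarith

/-- Nonnegativity of the quadratic form with matrix `!![a - t, t; t, b - t]`. -/
theorem two_point_nonneg {a b t : ℝ} (ha : t < a) (hab : t ^ 2 ≤ (a - t) * (b - t)) (u v : E) :
    0 ≤ a * ‖u‖ ^ 2 + b * ‖v‖ ^ 2 - t * ‖u - v‖ ^ 2 := by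
  have key : (a - t) * (a * ‖u‖ ^ 2 + b * ‖v‖ ^ 2 - t * ‖u - v‖ ^ 2) =
      ‖(a - t) • u + t • v‖ ^ 2 + ((a - t) * (b - t) - t ^ 2) * ‖v‖ ^ 2 := by
    simp only [← real_inner_self_eq_norm_sq, inner_add_left, inner_add_right, inner_sub_left,
      inner_sub_right, real_inner_smul_left, real_inner_smul_right, real_inner_comm u v]
    ring
  have : 0 ≤ (a - t) * (a * ‖u‖ ^ 2 + b * ‖v‖ ^ 2 - t * ‖u - v‖ ^ 2) := by
    rw [key]
    have := sub_nonneg.2 hab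
    positivity
  exact nonneg_of_mul_nonneg_right this (sub_pos.2 ha)

/-- The estimate satisfied by a block of `2 ^ k - 1` silver steps from `u` to `v`, both in `K`,
where `r = ρ ^ k`. The minorants `a` and `(r - 1) • y` collect, with the stepsizes as weights, the
interpolation inequalities of `f` and the subgradient inequalities of `h` along the block; their
mass is zero for `k = 0`, where `y` is immaterial. The vector `w` is the slope of a
convex combination of subgradient inequalities of `h`. For the silver schedule `d` is the reciprocal
of the stepsize `1 + r / ρ` that separates two such blocks. -/
def SilverBlock (f : E → ℝ) (g : E → E) (h : E → ℝ) (K : Set E) (r d : ℝ) (u v : E) : Prop :=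
  u ∈ K ∧ v ∈ K ∧ ∃ (a y w : E) (cf ch cw : ℝ),
    a + (r - 1) • y = u - v ∧
    IsSmoothMinorant f g (r - 1) a cf ∧
    IsAffineMinorant h K (r - 1) ((r - 1) • y) ch ∧
    IsAffineMinorant h K 1 w cw ∧
    0 ≤ ‖u‖ ^ 2 - ‖v‖ ^ 2 + 2 * (h u - h v) - 2 * (r - 1) * (f v + h v) + 2 * cf + 2 * ch
      - (r * (r - 1) * ‖g v + w‖ ^ 2 + (r - 1) * ‖y‖ ^ 2
        + 2 * (r * (r - 1)) * d * (h v - ⟪w, v⟫ - cw))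

/-- The estimate, relative to a reference point `p`, satisfied by the initial block of silver
steps, whose starting point `u` need not belong to `K`. As in `SilverBlock`, `w` is the slope of an
affine minorant of `h`, and `d` is the reciprocal of the next stepsize. -/
def SilverStart (f : E → ℝ) (g : E → E) (h : E → ℝ) (K : Set E) (p : E) (r M d : ℝ) (u v : E) :
    Prop :=
  v ∈ K ∧ ∃ (w : E) (cw : ℝ), IsAffineMinorant h K 1 w cw ∧
    0 ≤ ‖u - p‖ ^ 2 - ‖v - p‖ ^ 2 - 2 * (r - 1) * (f v + h v - f p - h p)
      - M * ‖g v + w‖ ^ 2 - 2 * M * d * (h v - ⟪w, v⟫ - cw)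

/-- The block without steps. -/
theorem SilverBlock.refl {f : E → ℝ} {g : E → E} {h : E → ℝ} {K : Set E} {v s : E} (hv : v ∈ K)
    (hs : IsSubgradientOn h K v s) (d : ℝ) : SilverBlock f g h K 1 d v v := by
  refine ⟨hv, hv, 0, 0, s, 0, 0, h v - ⟪s, v⟫, by simp, ?_, ?_, hs.isAffineMinorant, by simp⟩
  · intro z; simp
  · intro z _; simp

theorem SilverStart.mono {f : E → ℝ} {g : E → E} {h : E → ℝ} {K : Set E} {p : E}
    {r M M' d : ℝ} {u v : E} (hS : SilverStart f g h K p r M d u v) (hM : M' ≤ M) (hd : 0 ≤ d) :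
    SilverStart f g h K p r M' d u v := by
  obtain ⟨hv, w, cw, hw, H⟩ := hS
  refine ⟨hv, w, cw, hw, H.trans ?_⟩
  have h1 := mul_le_mul_of_nonneg_right hM (sq_nonneg ‖g v + w‖)
  have h2 : 0 ≤ h v - ⟪w, v⟫ - cw := by linarith [hw v hv]
  have h3 := mul_le_mul_of_nonneg_right (mul_le_mul_of_nonneg_right hM hd) h2
  linarith

end Blocks

/-! ### Gluing blocks -/

section Gluing

variable {E : Type*} [NormedAddCommGroup E] [InnerProductSpace ℝ E]

local notation "⟪" x ", " y "⟫" => inner ℝ x y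

/-- The weights of the combination proving `SilverBlock.glue`. The first block ends at `v`, a step
of size `1 + c` leads to `u`, and the second block ends at `z`; `g` and `q` are the gradients at
`v` and `z`, `s` is the subgradient at `u`, and `X` stands for the terms of the first block
that are carried along unchanged. Each summand on the right is a nonnegative multiple of a hypothesis
or of a square. The weighted sums of squares on the left are those to which Jensen's inequality applies. -/
theorem block_identity (ρ c d e X fv fz hv hu hz cf ch c₁ c₂ : ℝ)
    (v g s q a y w₁ w₂ u z : E) (hρ : ρ ^ 2 = 2 * ρ + 1) (hd : c * d = 1 - d)
    (hu' : u = v - (1 + c) • (g + s)) (hz' : z = u - (a + (ρ * c - 1) • y)) :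
    X - ‖z‖ ^ 2 - 2 * hz - 2 * (ρ * (ρ * c) - 1) * (fz + hz)
      + 2 * (1 + c) * (fv + 1 / 2 * ‖g‖ ^ 2 - ⟪g, v⟫) + 2 * cf
      + 2 * (1 + c) * (hu - ⟪s, u⟫) + 2 * ch
      - (ρ * (1 + c) * ‖q + s‖ ^ 2 + ρ * (ρ * c - 1) * ‖q + y‖ ^ 2
        + ρ ^ 2 * (ρ * c * (ρ * c - 1)) * ‖q + w₂‖ ^ 2)
      - ((1 + c) * ‖s‖ ^ 2 + (ρ * c - 1) * ‖y‖ ^ 2)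
      - 2 * e * (ρ * (1 + c) * (hz - hu - ⟪s, z - u⟫)
        + ρ * ((ρ * c - 1) * hz - ⟪(ρ * c - 1) • y, z⟫ - ch)
        + ρ ^ 2 * (ρ * c * (ρ * c - 1)) * (hz - ⟪w₂, z⟫ - c₂)) =
    (X - ‖v‖ ^ 2 - 2 * hv - 2 * (ρ * c - 1) * (fv + hv)
      - ρ * c * (ρ * c - 1) * ‖g + w₁‖ ^ 2
      - 2 * (ρ * c * (ρ * c - 1)) * d * (hv - ⟪w₁, v⟫ - c₁))
    + ρ ^ 2 * (‖u‖ ^ 2 - ‖z‖ ^ 2 + 2 * (hu - hz) - 2 * (ρ * c - 1) * (fz + hz) + 2 * cf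
      + 2 * ch - (ρ * c * (ρ * c - 1) * ‖q + w₂‖ ^ 2 + (ρ * c - 1) * ‖y‖ ^ 2
      + 2 * (ρ * c * (ρ * c - 1)) * d * (hz - ⟪w₂, z⟫ - c₂)))
    + 2 * ρ * ((ρ * c - 1) * (fv - 1 / 2 * ‖g‖ ^ 2) - ⟪a, v - g⟫ - cf)
    + 2 * ρ * ((ρ * c - 1) * (fz - 1 / 2 * ‖q‖ ^ 2) - ⟪a, z - q⟫ - cf)
    + 2 * ρ * (1 - d) * ((ρ * c - 1) * hv - ⟪(ρ * c - 1) • y, v⟫ - ch)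
    + 2 * ρ * d * ((ρ * c - 1) * hu - ⟪(ρ * c - 1) • y, u⟫ - ch)
    + 2 * ρ * (1 - e) * ((ρ * c - 1) * hz - ⟪(ρ * c - 1) • y, z⟫ - ch)
    + 2 * ρ * (fv - fz - ⟪q, v - z⟫ - 1 / 2 * ‖g - q‖ ^ 2)
    + 2 * (ρ * c) * (fz - fv - ⟪g, z - v⟫ - 1 / 2 * ‖q - g‖ ^ 2)
    + 2 * (ρ * c) * (hv - hu - ⟪s, v - u⟫)
    + 2 * ρ * (1 + c) * (1 - e) * (hz - hu - ⟪s, z - u⟫)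
    + 2 * (ρ * c * (ρ * c - 1)) * d * (hu - ⟪w₁, u⟫ - c₁)
    + ρ ^ 2 * (2 * (ρ * c * (ρ * c - 1))) * (d - e) * (hz - ⟪w₂, z⟫ - c₂)
    + ρ * c * (ρ * c - 1) * ‖w₁ - s‖ ^ 2
    + ρ * (ρ * c - 1) * ‖y - s‖ ^ 2 := by
  subst hz' hu'
  simp only [← real_inner_self_eq_norm_sq, inner_add_left, inner_add_right, inner_sub_left,
    inner_sub_right, real_inner_smul_left, real_inner_smul_right, real_inner_comm a g,
    real_inner_comm a q, real_inner_comm a s, real_inner_comm a v, real_inner_comm a w₂,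
    real_inner_comm a y, real_inner_comm g q, real_inner_comm g s, real_inner_comm g v,
    real_inner_comm g w₁, real_inner_comm g w₂, real_inner_comm g y, real_inner_comm q s,
    real_inner_comm q w₂, real_inner_comm q y, real_inner_comm s v, real_inner_comm s w₁,
    real_inner_comm s w₂, real_inner_comm s y, real_inner_comm v w₁, real_inner_comm v w₂,
    real_inner_comm v y]
  grind

/-- The weights of the combination proving `SilverStart.glue`, with the notation of `block_identity`
and with the gradient equal to zero at the comparison point `p`. The free parameters `α`, `α'` and
`χ` distribute the quadratic terms over the brackets in the last lines, which are nonnegative for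
`α' = α⁻¹` and suitable `α`, `χ`. -/
theorem start_identity (ρ c d e α α' M χ X fv fz hv hu hz fp hp cf ch c₁ c₂ l₁ l₂ : ℝ)
    (v g s q a y w₁ w₂ u z p : E) (hρ : ρ ^ 2 = 2 * ρ + 1) (hd : c * d = 1 - d)
    (hl₁ : l₁ = ρ - α * (ρ - 1) / 2) (hl₂ : l₂ = ρ - α * (ρ + 1) / 2)
    (hu' : u = v - (1 + c) • (g + s)) (hz' : z = u - (a + (ρ * c - 1) • y)) :
    X - ‖z - p‖ ^ 2 - 2 * (ρ * (ρ * c) - 1) * (fz + hz - fp - hp)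
      - ((l₂ * (1 + c) - χ) * ‖q + s‖ ^ 2 + l₂ * (ρ * c - 1) * ‖q + y‖ ^ 2
        + (1 + l₁ + l₂) * (ρ * c * (ρ * c - 1)) * ‖q + w₂‖ ^ 2)
      - 2 * e * ((l₂ * (1 + c) - χ) * (hz - hu - ⟪s, z - u⟫)
        + l₂ * ((ρ * c - 1) * hz - ⟪(ρ * c - 1) • y, z⟫ - ch)
        + (1 + l₁ + l₂) * (ρ * c * (ρ * c - 1)) * (hz - ⟪w₂, z⟫ - c₂)) =
    (X - ‖v - p‖ ^ 2 - 2 * (ρ * c - 1) * (fv + hv - fp - hp) - M * ‖g + w₁‖ ^ 2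
      - 2 * M * d * (hv - ⟪w₁, v⟫ - c₁))
    + 2 * (1 + c) * (fp - fv - ⟪g, p - v⟫ - 1 / 2 * ‖g‖ ^ 2)
    + 2 * (1 + c) * (hp - hu - ⟪s, p - u⟫)
    + (1 + l₁ + l₂) * (‖u‖ ^ 2 - ‖z‖ ^ 2 + 2 * (hu - hz) - 2 * (ρ * c - 1) * (fz + hz) + 2 * cf
      + 2 * ch - (ρ * c * (ρ * c - 1) * ‖q + w₂‖ ^ 2 + (ρ * c - 1) * ‖y‖ ^ 2
      + 2 * (ρ * c * (ρ * c - 1)) * d * (hz - ⟪w₂, z⟫ - c₂)))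
    + 2 * ((ρ * c - 1) * fp - ⟪a, p⟫ - cf)
    + 2 * l₁ * ((ρ * c - 1) * (fv - 1 / 2 * ‖g‖ ^ 2) - ⟪a, v - g⟫ - cf)
    + 2 * l₂ * ((ρ * c - 1) * (fz - 1 / 2 * ‖q‖ ^ 2) - ⟪a, z - q⟫ - cf)
    + 2 * ((ρ * c - 1) * hp - ⟪(ρ * c - 1) • y, p⟫ - ch)
    + 2 * l₁ * (1 - d) * ((ρ * c - 1) * hv - ⟪(ρ * c - 1) • y, v⟫ - ch)
    + 2 * l₁ * d * ((ρ * c - 1) * hu - ⟪(ρ * c - 1) • y, u⟫ - ch)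
    + 2 * l₂ * (1 - e) * ((ρ * c - 1) * hz - ⟪(ρ * c - 1) • y, z⟫ - ch)
    + 2 * l₂ * (fv - fz - ⟪q, v - z⟫ - 1 / 2 * ‖g - q‖ ^ 2)
    + 2 * ((1 + c) * l₂ - l₁) * (fz - fv - ⟪g, z - v⟫ - 1 / 2 * ‖q - g‖ ^ 2)
    + 2 * ((ρ * c - 1) * (1 - l₁ * (1 - d)) + M * d) * (hv - hu - ⟪s, v - u⟫)
    + 2 * (1 + (1 - e) * (l₂ * (1 + c)) + e * χ) * (hz - hu - ⟪s, z - u⟫)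
    + 2 * M * d * (hu - ⟪w₁, u⟫ - c₁)
    + (1 + l₁ + l₂) * (2 * (ρ * c * (ρ * c - 1))) * (d - e) * (hz - ⟪w₂, z⟫ - c₂)
    + (α * ‖u - z + (1 + c) • (g + s)‖ ^ 2 - 2 * ⟪u - z + (1 + c) • (g + s), s⟫
      + α' * ‖s‖ ^ 2)
    + M * ‖w₁ - s‖ ^ 2
    + ((M - ρ * c * (ρ * c - 1) + α * (ρ * c) * c) * ‖g + s‖ ^ 2 + χ * ‖q + s‖ ^ 2
      - α * ‖(g + s) - (q + s)‖ ^ 2)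
    + (ρ * c - 1) * (l₁ * ‖y - s‖ ^ 2 + ‖y‖ ^ 2) + (c + 1 - α') * ‖s‖ ^ 2 := by
  subst hz' hu' hl₁ hl₂
  simp only [← real_inner_self_eq_norm_sq, inner_add_left, inner_add_right, inner_sub_left,
    inner_sub_right, real_inner_smul_left, real_inner_smul_right, real_inner_comm a g,
    real_inner_comm a q, real_inner_comm a s, real_inner_comm a v, real_inner_comm a w₂,
    real_inner_comm a y, real_inner_comm g q, real_inner_comm g s, real_inner_comm g v,
    real_inner_comm g w₁, real_inner_comm g w₂, real_inner_comm g y, real_inner_comm q s,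
    real_inner_comm q w₂, real_inner_comm q y, real_inner_comm s v, real_inner_comm s w₁,
    real_inner_comm s w₂, real_inner_comm s y, real_inner_comm v w₁, real_inner_comm v w₂,
    real_inner_comm v y, real_inner_comm p g, real_inner_comm p s,
    real_inner_comm p v, real_inner_comm p a, real_inner_comm p y]
  grind

variable {f : E → ℝ} {g : E → E} {h : E → ℝ} {K : Set E}

/-- Two blocks of length `2 ^ k - 1` separated by a proximal gradient step of size `1 + c`, where
`ρ * c = ρ ^ k`, form a block of length `2 ^ (k + 1) - 1`. -/
theorem SilverBlock.glue {ρ c d e : ℝ} {u₀ v u z s : E} (hρ : ρ ^ 2 = 2 * ρ + 1) (hρ1 : 1 < ρ)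
    (hc : 1 ≤ ρ * c) (hd : c * d = 1 - d) (hd0 : 0 ≤ d) (hd1 : d ≤ 1) (hed : e ≤ d)
    (hf : IsCocoercive f g) (h₁ : SilverBlock f g h K (ρ * c) d u₀ v)
    (hs : IsSubgradientOn h K u s) (hu : u = v - (1 + c) • (g v + s))
    (h₂ : SilverBlock f g h K (ρ * c) d u z) :
    SilverBlock f g h K (ρ * (ρ * c)) e u₀ z := by
  obtain ⟨hu₀K, hvK, a₁, y₁, w₁, cf₁, ch₁, cw₁, ha₁, hf₁, hh₁, hw₁, H₁⟩ := h₁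
  obtain ⟨huK, hzK, a₂, y₂, w₂, cf₂, ch₂, cw₂, ha₂, hf₂, hh₂, hw₂, H₂⟩ := h₂
  have hc0 : 0 < c := pos_of_mul_pos_right (by linarith : 0 < ρ * c) (by linarith)
  have hR1 : 0 < ρ * (ρ * c) - 1 := by nlinarith
  have hR : 0 < ρ * (ρ * c) * (ρ * (ρ * c) - 1) := by positivity
  have hmass₁ : (ρ * c - 1) + (1 + c) + (ρ * c - 1) = ρ * (ρ * c) - 1 := by
    linear_combination -c * hρ
  have hmass₂ : ρ * (1 + c) + ρ * (ρ * c - 1) + ρ ^ 2 * (ρ * c * (ρ * c - 1)) =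
      ρ * (ρ * c) * (ρ * (ρ * c) - 1) := by
    linear_combination (-ρ * c) * hρ
  have hr0 : 0 ≤ ρ * c - 1 := by linarith
  have hrr : 0 ≤ ρ * c * (ρ * c - 1) := by nlinarith
  have hsm : IsAffineMinorant h K 1 s (h u - ⟪s, u⟫) := hs.isAffineMinorant
  refine ⟨hu₀K, hzK, a₁ + (1 + c) • g v + a₂,
    (ρ * (ρ * c) - 1)⁻¹ • ((ρ * c - 1) • y₁ + (1 + c) • s + (ρ * c - 1) • y₂),
    (ρ * (ρ * c) * (ρ * (ρ * c) - 1))⁻¹ • ((ρ * (1 + c)) • s + (ρ * (ρ * c - 1)) • y₂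
      + (ρ ^ 2 * (ρ * c * (ρ * c - 1))) • w₂),
    cf₁ + (1 + c) * (f v + 1 / 2 * ‖g v‖ ^ 2 - ⟪g v, v⟫) + cf₂,
    ch₁ + (1 + c) * (h u - ⟪s, u⟫) + ch₂,
    (ρ * (ρ * c) * (ρ * (ρ * c) - 1))⁻¹ * ((ρ * (1 + c)) * (h u - ⟪s, u⟫) + ρ * ch₂
      + (ρ ^ 2 * (ρ * c * (ρ * c - 1))) * cw₂), ?_, ?_, ?_, ?_, ?_⟩
  · rw [smul_inv_smul₀ hR1.ne']
    have e₁ : u₀ - v + (v - u) + (u - z) = u₀ - z := by abel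
    have e₂ : v - u = (1 + c) • g v + (1 + c) • s := by rw [hu, smul_add]; abel
    rw [← e₁, ← ha₁, ← ha₂, e₂]
    abel
  · have := (hf₁.add ((hf.isSmoothMinorant v).smul (by linarith : 0 ≤ 1 + c))).add hf₂
    rwa [mul_one, hmass₁] at this
  · rw [smul_inv_smul₀ hR1.ne']
    have := (hh₁.add (hsm.smul (by linarith : 0 ≤ 1 + c))).add hh₂
    rwa [mul_one, hmass₁] at this
  · have := (((hsm.smul (by positivity : 0 ≤ ρ * (1 + c))).add
      (hh₂.smul (by linarith : 0 ≤ ρ))).add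
      (hw₂.smul (by positivity : 0 ≤ ρ ^ 2 * (ρ * c * (ρ * c - 1))))).smul (inv_nonneg.2 hR.le)
    rwa [mul_one, mul_one, hmass₂, inv_mul_cancel₀ hR.ne', smul_smul ρ] at this
  · have J₁ := mul_norm_add_sq_le (by positivity : 0 ≤ ρ * (1 + c))
      (by positivity : 0 ≤ ρ * (ρ * c - 1)) (by positivity : 0 ≤ ρ ^ 2 * (ρ * c * (ρ * c - 1)))
      hR hmass₂ (g z) s y₂ w₂
    have J₂ := mul_norm_add_sq_le hr0 (by linarith : 0 ≤ 1 + c) hr0 hR1 hmass₁ 0 y₁ s y₂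
    simp only [zero_add] at J₂
    have key := block_identity ρ c d e (‖u₀‖ ^ 2 + 2 * h u₀ + 2 * cf₁ + 2 * ch₁
      - (ρ * c - 1) * ‖y₁‖ ^ 2) (f v) (f z) (h v) (h u) (h z) cf₂ ch₂ cw₁ cw₂ v (g v) s (g z) a₂
      y₂ w₁ w₂ u z hρ hd hu (by rw [ha₂]; abel)
    have hw : ρ * (ρ * c) * (ρ * (ρ * c) - 1) * (⟪(ρ * (ρ * c) * (ρ * (ρ * c) - 1))⁻¹ •
        ((ρ * (1 + c)) • s + (ρ * (ρ * c - 1)) • y₂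
          + (ρ ^ 2 * (ρ * c * (ρ * c - 1))) • w₂), z⟫
        + (ρ * (ρ * c) * (ρ * (ρ * c) - 1))⁻¹ * ((ρ * (1 + c)) * (h u - ⟪s, u⟫) + ρ * ch₂
          + (ρ ^ 2 * (ρ * c * (ρ * c - 1))) * cw₂)) =
        (ρ * (1 + c)) * (⟪s, z⟫ + (h u - ⟪s, u⟫)) + ρ * (⟪(ρ * c - 1) • y₂, z⟫ + ch₂)
        + (ρ ^ 2 * (ρ * c * (ρ * c - 1))) * (⟪w₂, z⟫ + cw₂) := by
      rw [real_inner_smul_left, ← mul_add, mul_inv_cancel_left₀ hR.ne']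
      simp only [inner_add_left, real_inner_smul_left]
      ring
    have Q := fun x y => sub_nonneg.2 (hf x y)
    have n₁ := mul_nonneg (sq_nonneg ρ) H₂
    have hρ0 : 0 ≤ 2 * ρ := by linarith
    have n₂ := mul_nonneg hρ0 (sub_nonneg.2 (hf₂ v))
    have n₃ := mul_nonneg hρ0 (sub_nonneg.2 (hf₂ z))
    have n₄ := mul_nonneg (mul_nonneg hρ0 (sub_nonneg.2 hd1)) (sub_nonneg.2 (hh₂ v hvK))
    have n₅ := mul_nonneg (mul_nonneg hρ0 hd0) (sub_nonneg.2 (hh₂ u huK))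
    have n₆ := mul_nonneg (mul_nonneg hρ0 (sub_nonneg.2 (hed.trans hd1)))
      (sub_nonneg.2 (hh₂ z hzK))
    have n₇ := mul_nonneg hρ0 (Q v z)
    have hr2 : 0 ≤ 2 * (ρ * c) := by linarith
    have n₈ := mul_nonneg hr2 (Q z v)
    have n₉ := mul_nonneg hr2 (sub_nonneg.2 (hs v hvK))
    have n₁₀ := mul_nonneg (mul_nonneg (mul_nonneg hρ0 (by linarith : 0 ≤ 1 + c))
      (sub_nonneg.2 (hed.trans hd1))) (sub_nonneg.2 (hs z hzK))
    have n₁₁ := mul_nonneg (mul_nonneg (by linarith : 0 ≤ 2 * (ρ * c * (ρ * c - 1))) hd0)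
      (sub_nonneg.2 (hw₁ u huK))
    have n₁₂ := mul_nonneg (mul_nonneg (mul_nonneg (sq_nonneg ρ)
      (by linarith : 0 ≤ 2 * (ρ * c * (ρ * c - 1)))) (sub_nonneg.2 hed))
      (sub_nonneg.2 (hw₂ z hzK))
    have n₁₃ := mul_nonneg hrr (sq_nonneg ‖w₁ - s‖)
    have n₁₄ := mul_nonneg (mul_nonneg (by linarith : 0 ≤ ρ) hr0) (sq_nonneg ‖y₂ - s‖)
    simp only [inner_sub_right] at key n₁ n₂ n₃ n₄ n₅ n₆ n₇ n₈ n₉ n₁₀ n₁₁ n₁₂ hw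
    generalize (ρ * (ρ * c) * (ρ * (ρ * c) - 1))⁻¹ * ((ρ * (1 + c)) * (h u - ⟪s, u⟫) + ρ * ch₂
      + (ρ ^ 2 * (ρ * c * (ρ * c - 1))) * cw₂) = cw at *
    generalize (ρ * (ρ * c) * (ρ * (ρ * c) - 1))⁻¹ •
        ((ρ * (1 + c)) • s + (ρ * (ρ * c - 1)) • y₂
          + (ρ ^ 2 * (ρ * c * (ρ * c - 1))) • w₂) = w at *
    have hw' := congrArg (fun t => 2 * e * t) hw
    have hm' := congrArg (fun t => 2 * e * h z * t) hmass₂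
    linarith
/-- The initial block, a proximal gradient step of size `1 + c`, where `ρ * c = ρ ^ k`, and a block
of length `2 ^ k - 1` form an initial block of length `2 ^ (k + 1) - 1`. -/
theorem SilverStart.glue {ρ c d e α M χ l₁ l₂ M' : ℝ} {p u₀ v u z s : E}
    (hρ : ρ ^ 2 = 2 * ρ + 1) (hc : 1 ≤ ρ * c) (hd : c * d = 1 - d) (hd0 : 0 ≤ d)
    (hd1 : d ≤ 1) (he0 : 0 ≤ e) (hed : e ≤ d) (hl₁ : l₁ = ρ - α * (ρ - 1) / 2)
    (hl₂ : l₂ = ρ - α * (ρ + 1) / 2) (hl₁0 : 0 ≤ l₁) (hl₂0 : 0 ≤ l₂) (hα : 0 < α) (hM : 0 ≤ M)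
    (hχ : 0 ≤ χ) (hχl : χ ≤ l₂ * (1 + c)) (hl : l₁ ≤ (1 + c) * l₂)
    (hM₁ : 0 ≤ (ρ * c - 1) * (1 - l₁ * (1 - d)) + M * d)
    (hμ : α < M - ρ * c * (ρ * c - 1) + α * (ρ * c) * c)
    (hμχ : α ^ 2 ≤ (M - ρ * c * (ρ * c - 1) + α * (ρ * c) * c - α) * (χ - α))
    (hαc : α⁻¹ ≤ c + 1) (hM'0 : 0 < M')
    (hM' : M' ≤ (l₂ * (1 + c) - χ) + l₂ * (ρ * c - 1) + (1 + l₁ + l₂) * (ρ * c * (ρ * c - 1)))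
    (hf : IsCocoercive f g) (hp : p ∈ K) (hgp : g p = 0)
    (h₁ : SilverStart f g h K p (ρ * c) M d u₀ v)
    (hs : IsSubgradientOn h K u s) (hu : u = v - (1 + c) • (g v + s))
    (h₂ : SilverBlock f g h K (ρ * c) d u z) :
    SilverStart f g h K p (ρ * (ρ * c)) M' e u₀ z := by
  refine SilverStart.mono ?_ hM' he0
  obtain ⟨hvK, w₁, cw₁, hw₁, H₁⟩ := h₁
  obtain ⟨huK, hzK, a₂, y₂, w₂, cf₂, ch₂, cw₂, ha₂, hf₂, hh₂, hw₂, H₂⟩ := h₂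
  have hr0 : 0 ≤ ρ * c - 1 := by linarith
  have hrr : 0 ≤ ρ * c * (ρ * c - 1) := by nlinarith
  have hl0 : 0 ≤ 1 + l₁ + l₂ := by linarith
  set m₁ := l₂ * (1 + c) - χ with hm₁
  set m₃ := (1 + l₁ + l₂) * (ρ * c * (ρ * c - 1)) with hm₃
  have hm₁0 : 0 ≤ m₁ := by linarith
  have hm₂0 : 0 ≤ l₂ * (ρ * c - 1) := by positivity
  have hm₃0 : 0 ≤ m₃ := by positivity
  obtain ⟨m, hmass⟩ : ∃ m, m₁ + l₂ * (ρ * c - 1) + m₃ = m := ⟨_, rfl⟩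
  have hm : 0 < m := by linarith
  rw [hmass]
  refine ⟨hzK, m⁻¹ • (m₁ • s + (l₂ * (ρ * c - 1)) • y₂ + m₃ • w₂),
    m⁻¹ * (m₁ * (h u - ⟪s, u⟫) + l₂ * ch₂ + m₃ * cw₂), ?_, ?_⟩
  · have := (((hs.isAffineMinorant.smul hm₁0).add (hh₂.smul hl₂0)).add
      (hw₂.smul hm₃0)).smul (inv_nonneg.2 hm.le)
    rwa [mul_one, mul_one, hmass, inv_mul_cancel₀ hm.ne', smul_smul l₂] at this
  · have J₁ := mul_norm_add_sq_le hm₁0 hm₂0 hm₃0 hm hmass (g z) s y₂ w₂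
    have hw : m * (⟪m⁻¹ • (m₁ • s + (l₂ * (ρ * c - 1)) • y₂ + m₃ • w₂), z⟫
        + m⁻¹ * (m₁ * (h u - ⟪s, u⟫) + l₂ * ch₂ + m₃ * cw₂)) =
        m₁ * (⟪s, z⟫ + (h u - ⟪s, u⟫)) + l₂ * (⟪(ρ * c - 1) • y₂, z⟫ + ch₂)
        + m₃ * (⟪w₂, z⟫ + cw₂) := by
      rw [real_inner_smul_left, ← mul_add, mul_inv_cancel_left₀ hm.ne']
      simp only [inner_add_left, real_inner_smul_left]
      ring
    have key := start_identity ρ c d e α α⁻¹ M χ (‖u₀ - p‖ ^ 2) (f v) (f z) (h v) (h u) (h z)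
      (f p) (h p) cf₂ ch₂ cw₁ cw₂ l₁ l₂ v (g v) s (g z) a₂ y₂ w₁ w₂ u z p hρ hd hl₁ hl₂ hu
      (by rw [ha₂]; abel)
    rw [← hm₁, ← hm₃] at key
    have hsq : 0 ≤ α * ‖u - z + (1 + c) • (g v + s)‖ ^ 2
        - 2 * ⟪u - z + (1 + c) • (g v + s), s⟫ + α⁻¹ * ‖s‖ ^ 2 := by
      generalize u - z + (1 + c) • (g v + s) = t
      have := mul_nonneg (inv_nonneg.2 hα.le) (sq_nonneg ‖α • t - s‖)
      rw [norm_sub_sq_real, norm_smul, real_inner_smul_left, mul_pow, Real.norm_eq_abs,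
        sq_abs] at this
      have e₁ : α⁻¹ * α = 1 := inv_mul_cancel₀ hα.ne'
      have e₂ : α⁻¹ * (α ^ 2 * ‖t‖ ^ 2 - 2 * (α * ⟪t, s⟫) + ‖s‖ ^ 2) =
          α * ‖t‖ ^ 2 - 2 * ⟪t, s⟫ + α⁻¹ * ‖s‖ ^ 2 := by
        linear_combination (α * ‖t‖ ^ 2 - 2 * ⟪t, s⟫) * e₁
      linarith
    have htp := two_point_nonneg hμ hμχ (g v + s) (g z + s)
    have hd1' : 0 ≤ 1 - d := by linarith
    have he1' : 0 ≤ 1 - e := by linarith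
    have hc1 : 0 ≤ 1 + c := le_trans (inv_nonneg.2 hα.le) (by linarith)
    have Qp := sub_nonneg.2 (hf p v)
    rw [hgp, zero_sub, norm_neg] at Qp
    have hFp := hf₂ p
    rw [hgp, sub_zero, norm_zero] at hFp
    have Q := fun x y => sub_nonneg.2 (hf x y)
    have n₁ := mul_nonneg (by linarith only [hc1] : 0 ≤ 2 * (1 + c)) Qp
    have n₂ := mul_nonneg (by linarith only [hc1] : 0 ≤ 2 * (1 + c)) (sub_nonneg.2 (hs p hp))
    have n₃ := mul_nonneg hl0 H₂
    have n₄ := mul_nonneg (by linarith only [hl₁0] : 0 ≤ 2 * l₁) (sub_nonneg.2 (hf₂ v))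
    have n₅ := mul_nonneg (by linarith only [hl₂0] : 0 ≤ 2 * l₂) (sub_nonneg.2 (hf₂ z))
    have n₆ := sub_nonneg.2 (hh₂ p hp)
    have n₇ := mul_nonneg (mul_nonneg (by linarith only [hl₁0] : 0 ≤ 2 * l₁) hd1')
      (sub_nonneg.2 (hh₂ v hvK))
    have n₈ := mul_nonneg (mul_nonneg (by linarith only [hl₁0] : 0 ≤ 2 * l₁) hd0)
      (sub_nonneg.2 (hh₂ u huK))
    have n₉ := mul_nonneg (mul_nonneg (by linarith only [hl₂0] : 0 ≤ 2 * l₂) he1')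
      (sub_nonneg.2 (hh₂ z hzK))
    have n₁₀ := mul_nonneg (by linarith only [hl₂0] : 0 ≤ 2 * l₂) (Q v z)
    have n₁₁ := mul_nonneg (by linarith only [hl] : 0 ≤ 2 * ((1 + c) * l₂ - l₁)) (Q z v)
    have n₁₂ := mul_nonneg
      (by linarith only [hM₁] : 0 ≤ 2 * ((ρ * c - 1) * (1 - l₁ * (1 - d)) + M * d))
      (sub_nonneg.2 (hs v hvK))
    have n₁₃ := mul_nonneg (by positivity : 0 ≤ 2 * (1 + (1 - e) * (l₂ * (1 + c)) + e * χ))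
      (sub_nonneg.2 (hs z hzK))
    have n₁₄ := mul_nonneg (by positivity : 0 ≤ 2 * M * d) (sub_nonneg.2 (hw₁ u huK))
    have n₁₅ := mul_nonneg (mul_nonneg (mul_nonneg hl0
      (by linarith only [hrr] : 0 ≤ 2 * (ρ * c * (ρ * c - 1)))) (sub_nonneg.2 hed))
      (sub_nonneg.2 (hw₂ z hzK))
    have n₁₆ := mul_nonneg hM (sq_nonneg ‖w₁ - s‖)
    have n₁₇ : 0 ≤ (ρ * c - 1) * (l₁ * ‖y₂ - s‖ ^ 2 + ‖y₂‖ ^ 2) := by positivity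
    have n₁₈ := mul_nonneg (sub_nonneg.2 hαc) (sq_nonneg ‖s‖)
    have hw' := congrArg (fun t => 2 * e * t) hw
    have hm' := congrArg (fun t => 2 * e * h z * t) hmass
    clear_value m₁ m₃
    clear hm₁ hm₃ hmass hw hμ hμχ hχl hM' hl hM₁ hρ hl₁ hl₂ hd hα hαc
    generalize m⁻¹ * (m₁ * (h u - ⟪s, u⟫) + l₂ * ch₂ + m₃ * cw₂) = cw at *
    generalize m⁻¹ • (m₁ • s + (l₂ * (ρ * c - 1)) • y₂ + m₃ • w₂) = w at *
    generalize ‖u - z + (1 + c) • (g v + s)‖ = tt at *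
    simp only [inner_sub_right] at key n₁ n₂ n₃ n₄ n₅ n₆ n₇ n₈ n₉ n₁₀ n₁₁ n₁₂ n₁₃ n₁₄ n₁₅ hw'
    linarith
end Gluing

/-! ### Short horizons and the final estimate -/

section Horizons

variable {E : Type*} [NormedAddCommGroup E] [InnerProductSpace ℝ E]

local notation "⟪" x ", " y "⟫" => inner ℝ x y

/-- The weights of the combination proving `SilverStart.base`: eighteen inequalities, followed by an
approximate `LDLᵀ` decomposition of the remaining quadratic form with rational entries, and
the rounding errors, which are diagonally dominant and written as multiples of `‖a ± b‖²` and
`‖a‖²`. -/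
theorem start_base_identity (σ f₀ f₁ f₂ f₃ h₁ h₂ h₃ fp hp : ℝ)
    (p x₀ x₁ x₂ x₃ g₀ g₁ g₂ g₃ s₁ s₂ s₃ : E) (hσ : σ ^ 2 = 2) (e₁ : x₁ = x₀ - σ • (g₀ + s₁))
    (e₂ : x₂ = x₁ - (2 : ℝ) • (g₁ + s₂)) (e₃ : x₃ = x₂ - σ • (g₂ + s₃)) :
    ‖x₀ - p‖ ^ 2 - ‖x₃ - p‖ ^ 2 - 2 * (2 + 2 * σ) * (f₃ + h₃ - fp - hp)
      - (79 / 10 + 11 / 2 * σ) * ‖g₃ + s₃‖ ^ 2 =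
    (2 * σ + 1 / 2) * (f₀ - f₁ - ⟪g₁, x₀ - x₁⟫ - 1 / 2 * ‖g₀ - g₁‖ ^ 2)
    + 1 / 2 * (f₁ - f₀ - ⟪g₀, x₁ - x₀⟫ - 1 / 2 * ‖g₁ - g₀‖ ^ 2)
    + 6 * (f₁ - f₂ - ⟪g₂, x₁ - x₂⟫ - 1 / 2 * ‖g₁ - g₂‖ ^ 2)
    + 13 / 5 * (f₁ - f₃ - ⟪g₃, x₁ - x₃⟫ - 1 / 2 * ‖g₁ - g₃‖ ^ 2)
    + (23 / 5 - 2 * σ) * (f₃ - f₁ - ⟪g₁, x₃ - x₁⟫ - 1 / 2 * ‖g₃ - g₁‖ ^ 2)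
    + (2 * σ + 81 / 5) * (f₂ - f₃ - ⟪g₃, x₂ - x₃⟫ - 1 / 2 * ‖g₂ - g₃‖ ^ 2)
    + 51 / 5 * (f₃ - f₂ - ⟪g₂, x₃ - x₂⟫ - 1 / 2 * ‖g₃ - g₂‖ ^ 2)
    + 22 / 5 * (h₁ - h₂ - ⟪s₂, x₁ - x₂⟫)
    + 11 / 10 * (h₁ - h₃ - ⟪s₃, x₁ - x₃⟫)
    + (11 / 2 - 2 * σ) * (h₂ - h₁ - ⟪s₁, x₂ - x₁⟫)
    + (2 * σ + 59 / 10) * (h₂ - h₃ - ⟪s₃, x₂ - x₃⟫)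
    + 3 * (h₃ - h₂ - ⟪s₂, x₃ - x₂⟫)
    + 2 * σ * (fp - f₀ - ⟪g₀, p - x₀⟫ - 1 / 2 * ‖g₀‖ ^ 2)
    + 4 * (fp - f₁ - ⟪g₁, p - x₁⟫ - 1 / 2 * ‖g₁‖ ^ 2)
    + 2 * σ * (fp - f₂ - ⟪g₂, p - x₂⟫ - 1 / 2 * ‖g₂‖ ^ 2)
    + 2 * σ * (hp - h₁ - ⟪s₁, p - x₁⟫)
    + 4 * (hp - h₂ - ⟪s₂, p - x₂⟫)
    + 2 * σ * (hp - h₃ - ⟪s₃, p - x₃⟫)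
    + 3 / 5 * ‖g₀ + (73 / 100 : ℝ) • g₁ - (59 / 100 : ℝ) • s₁‖ ^ 2
    + 1 / 5 * ‖s₃ - (48 / 25 : ℝ) • g₃ - (19 / 25 : ℝ) • g₁ - (131 / 100 : ℝ) • g₂
      - (511 / 100 : ℝ) • s₂‖ ^ 2
    + 9 / 25 * ‖g₃ + (17 / 50 : ℝ) • g₁ + (49 / 100 : ℝ) • g₂ + (177 / 100 : ℝ) • s₂‖ ^ 2
    + 26 / 25 * ‖g₁ + (143 / 100 : ℝ) • g₂ - (3 / 50 : ℝ) • s₁ + (157 / 100 : ℝ) • s₂‖ ^ 2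
    + 1 / 50 * ‖g₂ + (223 / 50 : ℝ) • s₁ - (134 / 25 : ℝ) • s₂‖ ^ 2
    + 34 / 25 * ‖s₁ - (77 / 50 : ℝ) • s₂‖ ^ 2
    + 3 / 50 * ‖s₂‖ ^ 2
    + (531 / 500 - 3 / 4 * σ) * ‖g₀ + g₁‖ ^ 2
    + (177 / 500 - 1 / 4 * σ) * ‖g₀ + s₁‖ ^ 2
    + (1379 / 250 - 39 / 10 * σ) * ‖s₃ - g₃‖ ^ 2
    + (23 / 10 * σ - 813 / 250) * ‖s₃ - g₁‖ ^ 2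
    + (8 / 5 * σ - 1131 / 500) * ‖s₃ - g₂‖ ^ 2
    + (1061 / 500 - 3 / 2 * σ) * ‖s₃ + s₂‖ ^ 2
    + (8839 / 6250 - σ) * ‖g₃ - g₁‖ ^ 2
    + (148493 / 12500 - 42 / 5 * σ) * ‖g₃ - g₂‖ ^ 2
    + 7 / 12500 * ‖g₃ + s₂‖ ^ 2
    + (406713 / 125000 - 23 / 10 * σ) * ‖g₁ + g₂‖ ^ 2
    + (9 / 4 * σ - 158959 / 50000) * ‖g₁ + s₁‖ ^ 2
    + (2 * σ - 353271 / 125000) * ‖g₁ + s₂‖ ^ 2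
    + 1 / 31250 * ‖g₂ + s₁‖ ^ 2
    + (3 / 2 * σ - 66289 / 31250) * ‖g₂ - s₂‖ ^ 2
    + (35369 / 12500 - 2 * σ) * ‖s₁ - s₂‖ ^ 2
    + (5 / 2 * σ - 879 / 250) * ‖g₀‖ ^ 2
    + (3 / 2 * σ - 32648 / 15625) * ‖g₁‖ ^ 2
    + (21843 / 25000 - 3 / 5 * σ) * ‖g₂‖ ^ 2
    + (39 / 5 * σ - 68797 / 6250) * ‖g₃‖ ^ 2
    + 3149 / 125000 * ‖s₁‖ ^ 2
    + 2701 / 125000 * ‖s₂‖ ^ 2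
    + (3 * σ - 528 / 125) * ‖s₃‖ ^ 2 := by
  subst e₃ e₂ e₁
  simp only [← real_inner_self_eq_norm_sq, inner_add_left, inner_add_right, inner_sub_left,
    inner_sub_right, real_inner_smul_left, real_inner_smul_right, real_inner_comm p x₀,
    real_inner_comm p g₀, real_inner_comm x₀ g₀, real_inner_comm p g₁, real_inner_comm x₀ g₁,
    real_inner_comm g₀ g₁, real_inner_comm p g₂, real_inner_comm x₀ g₂, real_inner_comm g₀ g₂,
    real_inner_comm g₁ g₂, real_inner_comm x₀ g₃, real_inner_comm g₀ g₃, real_inner_comm g₁ g₃,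
    real_inner_comm g₂ g₃, real_inner_comm p s₁, real_inner_comm x₀ s₁, real_inner_comm g₀ s₁,
    real_inner_comm g₁ s₁, real_inner_comm g₂ s₁, real_inner_comm p s₂, real_inner_comm x₀ s₂,
    real_inner_comm g₀ s₂, real_inner_comm g₁ s₂, real_inner_comm g₂ s₂, real_inner_comm g₃ s₂,
    real_inner_comm s₁ s₂, real_inner_comm p s₃, real_inner_comm x₀ s₃, real_inner_comm g₀ s₃,
    real_inner_comm g₁ s₃, real_inner_comm g₂ s₃, real_inner_comm g₃ s₃, real_inner_comm s₁ s₃,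
    real_inner_comm s₂ s₃]
  grind

variable {f : E → ℝ} {g : E → E} {h : E → ℝ} {K : Set E}

theorem IsCocoercive.le_of_gradient_eq_zero (hf : IsCocoercive f g) {p : E} (hgp : g p = 0)
    (x : E) : f x + ⟪g x, p - x⟫ + 1 / 2 * ‖g x‖ ^ 2 ≤ f p := by
  have := hf p x
  rwa [hgp, zero_sub, norm_neg] at this

theorem sqrt_two_bounds : (1.41421 : ℝ) < √2 ∧ √2 < 1.414215 :=
  ⟨Real.lt_sqrt_of_sq_lt (by norm_num), (Real.sqrt_lt' (by norm_num)).2 (by norm_num)⟩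

theorem sqrt_two_sq : √2 ^ 2 = (2 : ℝ) := Real.sq_sqrt (by norm_num)

/-- The three steps of sizes `√2, 2, √2` form an initial block. -/
theorem SilverStart.base (hf : IsCocoercive f g) {p x₀ x₁ x₂ x₃ s₁ s₂ s₃ : E} (hp : p ∈ K)
    (hgp : g p = 0) (h₁ : x₁ ∈ K) (h₂ : x₂ ∈ K) (h₃ : x₃ ∈ K) (hs₁ : IsSubgradientOn h K x₁ s₁)
    (hs₂ : IsSubgradientOn h K x₂ s₂) (hs₃ : IsSubgradientOn h K x₃ s₃)
    (e₁ : x₁ = x₀ - √2 • (g x₀ + s₁)) (e₂ : x₂ = x₁ - (2 : ℝ) • (g x₁ + s₂))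
    (e₃ : x₃ = x₂ - √2 • (g x₂ + s₃)) (d : ℝ) :
    SilverStart f g h K p (3 + 2 * √2) (79 / 10 + 11 / 2 * √2) d x₀ x₃ := by
  refine ⟨h₃, s₃, h x₃ - ⟪s₃, x₃⟫, hs₃.isAffineMinorant, ?_⟩
  have key := start_base_identity √2 (f x₀) (f x₁) (f x₂) (f x₃) (h x₁) (h x₂) (h x₃) (f p) (h p)
    p x₀ x₁ x₂ x₃ (g x₀) (g x₁) (g x₂) (g x₃) s₁ s₂ s₃ sqrt_two_sq e₁ e₂ e₃
  suffices H : 0 ≤ ‖x₀ - p‖ ^ 2 - ‖x₃ - p‖ ^ 2 - 2 * (2 + 2 * √2) * (f x₃ + h x₃ - f p - h p)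
      - (79 / 10 + 11 / 2 * √2) * ‖g x₃ + s₃‖ ^ 2 from H.trans_eq (by ring)
  rw [key]
  obtain ⟨l, u⟩ := sqrt_two_bounds
  have hp' := hf.le_of_gradient_eq_zero hgp
  repeat' refine add_nonneg ?_ ?_
  all_goals refine mul_nonneg (by linarith only [l, u]) ?_
  · linarith only [hf x₀ x₁]
  · linarith only [hf x₁ x₀]
  · linarith only [hf x₁ x₂]
  · linarith only [hf x₁ x₃]
  · linarith only [hf x₃ x₁]
  · linarith only [hf x₂ x₃]
  · linarith only [hf x₃ x₂]
  · linarith only [hs₂ x₁ h₁]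
  · linarith only [hs₃ x₁ h₁]
  · linarith only [hs₁ x₂ h₂]
  · linarith only [hs₃ x₂ h₂]
  · linarith only [hs₂ x₃ h₃]
  · linarith only [hp' x₀]
  · linarith only [hp' x₁]
  · linarith only [hp' x₂]
  · linarith only [hs₁ p hp]
  · linarith only [hs₂ p hp]
  · linarith only [hs₃ p hp]
  all_goals exact sq_nonneg _

/-- The rate for a single step of size `√2`. -/
theorem one_step_estimate (hf : IsCocoercive f g) {p x₀ x₁ s₁ : E} (hp : p ∈ K) (hgp : g p = 0)
    (hs₁ : IsSubgradientOn h K x₁ s₁) (e₁ : x₁ = x₀ - √2 • (g x₀ + s₁)) :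
    4 * √2 * (f x₁ + h x₁ - (f p + h p)) ≤ ‖x₀ - p‖ ^ 2 := by
  have key : ∀ (σ f₀ f₁ h₁ fp hp : ℝ) (g₀ g₁ : E), σ ^ 2 = 2 → x₁ = x₀ - σ • (g₀ + s₁) →
      ‖x₀ - p‖ ^ 2 - 4 * σ * (f₁ + h₁ - (fp + hp)) =
      2 * σ * (f₀ - f₁ - ⟪g₁, x₀ - x₁⟫ - 1 / 2 * ‖g₀ - g₁‖ ^ 2)
      + 2 * σ * (fp - f₀ - ⟪g₀, p - x₀⟫ - 1 / 2 * ‖g₀‖ ^ 2)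
      + 2 * σ * (fp - f₁ - ⟪g₁, p - x₁⟫ - 1 / 2 * ‖g₁‖ ^ 2)
      + 4 * σ * (hp - h₁ - ⟪s₁, p - x₁⟫)
      + 1 * ‖x₁ - p - σ • (g₁ + s₁)‖ ^ 2
      + 2 * (σ - 1) * ‖g₀ + (σ / 2) • g₁‖ ^ 2 + (σ - 1) * ‖g₁‖ ^ 2 := by
    intro σ f₀ f₁ h₁ fp hp g₀ g₁ hσ e
    subst e
    simp only [← real_inner_self_eq_norm_sq, inner_add_left, inner_add_right, inner_sub_left,
      inner_sub_right, real_inner_smul_left, real_inner_smul_right, real_inner_comm p x₀,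
      real_inner_comm p g₀, real_inner_comm p g₁, real_inner_comm p s₁, real_inner_comm x₀ g₀,
      real_inner_comm x₀ g₁, real_inner_comm x₀ s₁, real_inner_comm g₀ g₁, real_inner_comm g₀ s₁,
      real_inner_comm g₁ s₁]
    grind
  obtain ⟨l, u⟩ := sqrt_two_bounds
  have hp' := hf.le_of_gradient_eq_zero hgp
  rw [← sub_nonneg, key √2 (f x₀) (f x₁) (h x₁) (f p) (h p) (g x₀) (g x₁) sqrt_two_sq e₁]
  repeat' refine add_nonneg ?_ ?_
  all_goals refine mul_nonneg (by linarith only [l, u]) ?_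
  · linarith only [hf x₀ x₁]
  · linarith only [hp' x₀]
  · linarith only [hp' x₁]
  · linarith only [hs₁ p hp]
  all_goals exact sq_nonneg _

/-- The estimate for an initial block gains a further multiple `b` of the objective gap when the
optimality of `p` is tested against the last iterate. -/
theorem SilverStart.estimate {p u v : E} {r M d b : ℝ} (hf : IsCocoercive f g) (hp : p ∈ K)
    (hgp : g p = 0) (hb : 0 ≤ b) (hM : b ^ 2 ≤ M) (hMd : b ≤ M * d)
    (hS : SilverStart f g h K p r M d u v) :
    2 * (r - 1 + b) * (f v + h v - (f p + h p)) ≤ ‖u - p‖ ^ 2 := by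
  obtain ⟨hv, w, cw, hw, H⟩ := hS
  have n₁ := mul_nonneg hb (sub_nonneg.2 (hf.le_of_gradient_eq_zero hgp v))
  have n₂ := mul_nonneg hb (sub_nonneg.2 (hw p hp))
  have n₃ := mul_nonneg (sub_nonneg.2 hMd) (sub_nonneg.2 (hw v hv))
  have n₄ := mul_nonneg (sub_nonneg.2 hM) (sq_nonneg ‖g v + w‖)
  have n₅ := mul_nonneg hb (sq_nonneg ‖g v‖)
  have n₆ := sq_nonneg ‖v - p - b • (g v + w)‖
  rw [norm_sub_sq_real (v - p), norm_smul, mul_pow, Real.norm_eq_abs, sq_abs,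
    real_inner_smul_right, real_inner_comm] at n₆
  simp only [inner_add_left, inner_sub_right] at n₁ n₂ n₃ n₆
  linarith

end Horizons

/-! ### Runs with the silver schedule -/

section Runs

variable {E : Type*} [NormedAddCommGroup E] [InnerProductSpace ℝ E]

theorem silverRatio_sq : silverRatio ^ 2 = 2 * silverRatio + 1 := by
  have := sqrt_two_sq
  unfold silverRatio
  linear_combination this

theorem silverRatio_bounds : (2.41421 : ℝ) < silverRatio ∧ silverRatio < 2.414215 := by
  obtain ⟨l, u⟩ := sqrt_two_bounds
  unfold silverRatio
  constructor <;> linarith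

theorem silverRatio_pos : 0 < silverRatio := by linarith [silverRatio_bounds.1]

theorem silverRatio_inv : silverRatio⁻¹ = √2 - 1 := by
  rw [inv_eq_iff_eq_inv, eq_comm, inv_eq_iff_eq_inv, eq_comm]
  refine inv_eq_of_mul_eq_one_left ?_
  have := sqrt_two_sq
  unfold silverRatio
  linear_combination this

/-- The stepsize at time `2 ^ k * m - 1` with `m` odd. -/
theorem silverStep_eq {k m t : ℕ} (hm : Odd m) (ht : t + 1 = 2 ^ k * m) :
    silverStep 1 t = 1 + silverRatio ^ k / silverRatio := by
  have hm0 : m ≠ 0 := fun h0 => by simp [h0] at hm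
  have hv : padicValNat 2 (t + 1) = k := by
    rw [ht, padicValNat.mul (by positivity) hm0, padicValNat.prime_pow,
      padicValNat.eq_zero_of_not_dvd hm.not_two_dvd_nat, add_zero]
  rw [silverStep, hv, zpow_sub_one₀ silverRatio_pos.ne', zpow_natCast, div_one, add_comm,
    div_eq_mul_inv]

/-- `x 0, …, x n` is a run of `n` steps of the proximal gradient method with stepsizes `α`, where
`s (t + 1)` is the subgradient of `h` at `x (t + 1)` that the step selects. -/
def IsSubgradientRun (g : E → E) (h : E → ℝ) (K : Set E) (α : ℕ → ℝ) (n : ℕ) (x s : ℕ → E) :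
    Prop :=
  ∀ t < n, x (t + 1) ∈ K ∧ IsSubgradientOn h K (x (t + 1)) (s (t + 1)) ∧
    x (t + 1) = x t - α t • (g (x t) + s (t + 1))

variable {f : E → ℝ} {g : E → E} {h : E → ℝ} {K : Set E} {x s : ℕ → E} {n : ℕ}

theorem silverBlock_of_run (hf : IsCocoercive f g)
    (hx : IsSubgradientRun g h K (silverStep 1) n x s) (k q : ℕ) (hq : 1 ≤ q)
    (hn : 2 ^ k * q + 2 ^ k ≤ n + 1) :
    SilverBlock f g h K (silverRatio ^ k) (1 + silverRatio ^ k / silverRatio)⁻¹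
      (x (2 ^ k * q)) (x (2 ^ k * q + (2 ^ k - 1))) := by
  obtain ⟨l, u⟩ := silverRatio_bounds
  induction k generalizing q with
  | zero =>
    obtain ⟨hK, hs, -⟩ := hx (q - 1) (by simp at hn; omega)
    rw [Nat.sub_add_cancel hq] at hK hs
    simpa using SilverBlock.refl hK hs (1 + silverRatio⁻¹)⁻¹
  | succ k ih =>
    have hp : 1 ≤ 2 ^ k := Nat.one_le_two_pow
    rw [pow_succ, mul_assoc] at hn
    have h₁ := ih (2 * q) (by omega) (by omega)
    have h₂ := ih (2 * q + 1) (by omega) (by rw [mul_add, mul_one]; omega)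
    have ht : 2 ^ k * (2 * q) + (2 ^ k - 1) + 1 = 2 ^ k * (2 * q + 1) := by
      rw [mul_add, mul_one]; omega
    obtain ⟨-, hs, hst⟩ := hx (2 ^ k * (2 * q) + (2 ^ k - 1)) (by omega)
    rw [silverStep_eq (odd_two_mul_add_one q) ht, ht] at hst
    rw [ht] at hs
    have hr1 : 1 ≤ silverRatio ^ k := one_le_pow₀ (by linarith)
    have hr0 : 0 ≤ silverRatio ^ k := by linarith
    have hρ1 : 1 ≤ silverRatio := by linarith
    have hc : silverRatio * (silverRatio ^ k / silverRatio) = silverRatio ^ k :=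
      mul_div_cancel₀ _ silverRatio_pos.ne'
    have hc0 : 0 < silverRatio ^ k / silverRatio := div_pos (by linarith) (by linarith)
    have key := SilverBlock.glue (ρ := silverRatio) (c := silverRatio ^ k / silverRatio)
      (d := (1 + silverRatio ^ k / silverRatio)⁻¹) (e := (1 + silverRatio ^ k)⁻¹)
      silverRatio_sq (by linarith) (by rw [hc]; exact hr1) (by field_simp; ring)
      (by positivity) (inv_le_one_of_one_le₀ (by linarith))
      (inv_anti₀ (by positivity) (by linarith [div_le_self hr0 hρ1])) hf (by rw [hc]; exact h₁)
      hs hst (by rw [hc]; exact h₂)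
    rw [hc, ← pow_succ'] at key
    rw [show silverRatio ^ (k + 1) / silverRatio = silverRatio ^ k by
      rw [pow_succ, mul_div_cancel_right₀ _ silverRatio_pos.ne']]
    have e₁ : 2 ^ (k + 1) * q = 2 ^ k * (2 * q) := by ring
    have e₂ : 2 ^ (k + 1) * q + (2 ^ (k + 1) - 1) = 2 ^ k * (2 * q + 1) + (2 ^ k - 1) := by
      rw [pow_succ, mul_add, mul_one, mul_assoc]; omega
    rwa [e₂, e₁]

/-- The recursion for initial blocks with the parameters of the silver schedule, where
`ρ * c = ρ ^ k` for some `k ≥ 2`. The weight `α = 13 / 10 - 1 / (2 c)` makes the coefficient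
`M - ρ c (ρ c - 1) + α ρ c ^ 2` equal to `ρ c / 2`. -/
theorem SilverStart.succ {p u₀ v u z s : E} {c : ℝ} (hf : IsCocoercive f g) (hp : p ∈ K)
    (hgp : g p = 0) (hc : silverRatio ≤ c)
    (h₁ : SilverStart f g h K p (silverRatio * c)
      ((silverRatio ^ 2 - 13 / 10 * silverRatio) * c ^ 2)
      (1 + c)⁻¹ u₀ v)
    (hs : IsSubgradientOn h K u s) (hu : u = v - (1 + c) • (g v + s))
    (h₂ : SilverBlock f g h K (silverRatio * c) (1 + c)⁻¹ u z) :
    SilverStart f g h K p (silverRatio * (silverRatio * c))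
      ((silverRatio ^ 2 - 13 / 10 * silverRatio) * (silverRatio * c) ^ 2)
      (1 + silverRatio * c)⁻¹ u₀ z := by
  have hρ := silverRatio_sq
  obtain ⟨l, u⟩ := silverRatio_bounds
  generalize silverRatio = ρ at *
  have hc0 : 0 < c := by linarith
  obtain ⟨i, hi⟩ : ∃ i, c * i = 1 := ⟨c⁻¹, mul_inv_cancel₀ hc0.ne'⟩
  have hi0 : 0 < i := pos_of_mul_pos_right (by linarith : 0 < c * i) hc0.le
  have hi1 : i < 0.415 := by nlinarith
  have hd0 : 0 < (1 + c)⁻¹ := by positivity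
  have hd : (1 + c) * (1 + c)⁻¹ = 1 := mul_inv_cancel₀ (by positivity)
  have hρc : ρ ^ 2 ≤ ρ * c := by nlinarith
  have hcc : ρ * c ≤ c * c := by nlinarith
  refine h₁.glue (α := 13 / 10 - i / 2) (χ := 9 / 5) (l₁ := ρ - (13 / 10 - i / 2) * (ρ - 1) / 2)
    (l₂ := ρ - (13 / 10 - i / 2) * (ρ + 1) / 2) hρ (by nlinarith) (by linarith) hd0.le
    (inv_le_one_of_one_le₀ (by linarith)) (by positivity)
    (inv_anti₀ (by positivity) (by nlinarith)) rfl rfl ?_ ?_ (by linarith) ?_ (by norm_num) ?_ ?_ ?_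
    ?_ ?_ ?_ ?_ ?_ hf hp hgp hs hu h₂
  · nlinarith
  · nlinarith
  · have : 0 ≤ ρ ^ 2 - 13 / 10 * ρ := by nlinarith
    positivity
  · nlinarith
  · nlinarith
  · have e : (ρ * c - 1) * (1 - (ρ - (13 / 10 - i / 2) * (ρ - 1) / 2) * (1 - (1 + c)⁻¹))
        + (ρ ^ 2 - 13 / 10 * ρ) * c ^ 2 * (1 + c)⁻¹ =
        ((ρ * c - 1) * (1 + c - (ρ - (13 / 10 - i / 2) * (ρ - 1) / 2) * c)
          + (ρ ^ 2 - 13 / 10 * ρ) * c ^ 2) * (1 + c)⁻¹ := by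
      linear_combination (-(ρ * c - 1) * (1 - (ρ - (13 / 10 - i / 2) * (ρ - 1) / 2))) * hd
    rw [e]
    refine mul_nonneg ?_ hd0.le
    have e : (ρ * c - 1) * (1 + c - (ρ - (13 / 10 - i / 2) * (ρ - 1) / 2) * c)
          + (ρ ^ 2 - 13 / 10 * ρ) * c ^ 2 =
        (ρ * c - 1) * ((5 - ρ) / 4) + 7 / 20 * (ρ - 1) * c
          + (13 / 20 * ρ - 19 / 20) * ρ * c ^ 2 := by
      linear_combination ((ρ - 1) / 4 * (1 - ρ * c)) * hi
    rw [e]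
    have h₁ : 0 ≤ ρ * c - 1 := by nlinarith
    have h₂ : 0 ≤ (5 - ρ) / 4 := by linarith
    have h₃ : 0 ≤ 7 / 20 * (ρ - 1) := by linarith
    have h₄ : 0 ≤ 13 / 20 * ρ - 19 / 20 := by linarith
    positivity
  · have e : (ρ ^ 2 - 13 / 10 * ρ) * c ^ 2 - ρ * c * (ρ * c - 1) + (13 / 10 - i / 2) * (ρ * c) * c
      = ρ * c / 2 := by linear_combination (-ρ * c / 2) * hi
    rw [e]
    nlinarith
  · have e : (ρ ^ 2 - 13 / 10 * ρ) * c ^ 2 - ρ * c * (ρ * c - 1) + (13 / 10 - i / 2) * (ρ * c) * c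
      = ρ * c / 2 := by linear_combination (-ρ * c / 2) * hi
    rw [e]
    -- the tangent line of `1 / c` at `c = 1 + √2` bounds `i` from below
    have ht : 0.828 - 0.1716 * c ≤ i := by nlinarith [mul_nonneg hi0.le (sq_nonneg (1 - 0.414 * c))]
    nlinarith
  · rw [inv_le_comm₀ (by linarith) (by linarith)]
    rw [inv_le_iff_one_le_mul₀ (by linarith)]
    nlinarith
  · have : 0 < ρ ^ 2 - 13 / 10 * ρ := by nlinarith
    positivity
  · have e : (ρ - (13 / 10 - i / 2) * (ρ + 1) / 2) * (1 + c) - 9 / 5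
        + (ρ - (13 / 10 - i / 2) * (ρ + 1) / 2) * (ρ * c - 1)
        + (1 + (ρ - (13 / 10 - i / 2) * (ρ - 1) / 2) + (ρ - (13 / 10 - i / 2) * (ρ + 1) / 2))
          * (ρ * c * (ρ * c - 1)) - (ρ ^ 2 - 13 / 10 * ρ) * (ρ * c) ^ 2 = ρ * c / 2 - 9 / 5 := by
      grind
    nlinarith

theorem one_add_one_div_silverRatio : 1 + 1 / silverRatio = √2 := by
  rw [one_div, silverRatio_inv]; ring

theorem IsSubgradientRun.mono {α : ℕ → ℝ} {m : ℕ} (hx : IsSubgradientRun g h K α n x s)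
    (hmn : m ≤ n) : IsSubgradientRun g h K α m x s :=
  fun t ht => hx t (ht.trans_le hmn)

/-- A run of `2 ^ k - 1` steps, `k ≥ 2`, is an initial block, where `ρ * c = ρ ^ k`. -/
theorem silverStart_of_run (hf : IsCocoercive f g) {p : E} (hp : p ∈ K) (hgp : g p = 0) (k : ℕ)
    (hk : 2 ≤ k) (hx : IsSubgradientRun g h K (silverStep 1) (2 ^ k - 1) x s) :
    SilverStart f g h K p (silverRatio ^ k)
      ((silverRatio ^ 2 - 13 / 10 * silverRatio) * (silverRatio ^ k / silverRatio) ^ 2)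
      (1 + silverRatio ^ k / silverRatio)⁻¹ (x 0) (x (2 ^ k - 1)) := by
  obtain ⟨l, u⟩ := silverRatio_bounds
  induction k, hk using Nat.le_induction with
  | base =>
    obtain ⟨hK₁, hs₁, e₁⟩ := hx 0 (by norm_num)
    obtain ⟨hK₂, hs₂, e₂⟩ := hx 1 (by norm_num)
    obtain ⟨hK₃, hs₃, e₃⟩ := hx 2 (by norm_num)
    rw [silverStep_eq (k := 0) (m := 1) odd_one (by norm_num), pow_zero,
      one_add_one_div_silverRatio] at e₁
    rw [silverStep_eq (k := 1) (m := 1) odd_one (by norm_num), pow_one,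
      div_self silverRatio_pos.ne', (one_add_one_eq_two : (1 : ℝ) + 1 = 2)] at e₂
    rw [silverStep_eq (k := 0) (m := 3) (by decide) (by norm_num), pow_zero,
      one_add_one_div_silverRatio] at e₃
    convert SilverStart.base hf hp hgp hK₁ hK₂ hK₃ hs₁ hs₂ hs₃ e₁ e₂ e₃ _ using 1
    · rw [silverRatio_sq, silverRatio]; ring
    · rw [sq silverRatio, mul_div_cancel_right₀ _ silverRatio_pos.ne', silverRatio]
      have := sqrt_two_sq
      grind
    · rfl
  | succ k hk ih =>
    have hp2 : 1 ≤ 2 ^ k := Nat.one_le_two_pow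
    have hn : 2 ^ (k + 1) = 2 ^ k + 2 ^ k := by ring
    have h₁ := ih (hx.mono (by omega))
    have h₂ := silverBlock_of_run hf hx k 1 le_rfl (by omega)
    obtain ⟨-, hs, hst⟩ := hx (2 ^ k - 1) (by omega)
    rw [silverStep_eq (k := k) (m := 1) odd_one (by omega), Nat.sub_add_cancel hp2] at hst
    rw [Nat.sub_add_cancel hp2] at hs
    rw [mul_one, show 2 ^ k + (2 ^ k - 1) = 2 ^ (k + 1) - 1 by omega] at h₂
    have hc : silverRatio * (silverRatio ^ k / silverRatio) = silverRatio ^ k :=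
      mul_div_cancel₀ _ silverRatio_pos.ne'
    have hck : silverRatio ≤ silverRatio ^ k / silverRatio := by
      rw [le_div_iff₀ silverRatio_pos, ← sq]
      exact pow_le_pow_right₀ (by linarith) hk
    have key := SilverStart.succ hf hp hgp hck (by rwa [hc]) hs hst (by rwa [hc])
    rw [hc, ← pow_succ'] at key
    rwa [pow_succ' _ k, mul_div_cancel_left₀ _ silverRatio_pos.ne', ← pow_succ']

/-- The rate at the horizon `2 ^ k - 1`, in the normalization `M = 1` and relative to a point `p`
at which the smooth part is stationary. -/
theorem normalized_rate (hf : IsCocoercive f g) {p : E} (hp : p ∈ K) (hgp : g p = 0) {k : ℕ}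
    (hk : 1 ≤ k) (hx : IsSubgradientRun g h K (silverStep 1) (2 ^ k - 1) x s) :
    4 * √2 * (silverRatio ^ k / silverRatio) *
      (f (x (2 ^ k - 1)) + h (x (2 ^ k - 1)) - (f p + h p)) ≤ ‖x 0 - p‖ ^ 2 := by
  obtain ⟨l, u⟩ := silverRatio_bounds
  obtain rfl | hk := hk.eq_or_lt
  · obtain ⟨hK₁, hs₁, e₁⟩ := hx 0 (by norm_num)
    rw [silverStep_eq (k := 0) (m := 1) odd_one (by norm_num), pow_zero,
      one_add_one_div_silverRatio] at e₁
    simpa [silverRatio_pos.ne'] using one_step_estimate hf hp hgp hs₁ e₁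
  · have hS := silverStart_of_run hf hp hgp k hk hx
    have hc : silverRatio * (silverRatio ^ k / silverRatio) = silverRatio ^ k :=
      mul_div_cancel₀ _ silverRatio_pos.ne'
    have hck : silverRatio ≤ silverRatio ^ k / silverRatio := by
      rw [le_div_iff₀ silverRatio_pos, ← sq]
      exact pow_le_pow_right₀ (by linarith) hk
    rw [← hc] at hS
    rw [mul_div_cancel_left₀ _ silverRatio_pos.ne'] at hS
    generalize silverRatio ^ k / silverRatio = c at *
    have hb := hS.estimate (b := 1 + c * (√2 - 1)) hf hp hgp
    have hσ := sqrt_two_sq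
    obtain ⟨l', u'⟩ := sqrt_two_bounds
    have hm : (1.7 + 0.7 * √2) = silverRatio ^ 2 - 13 / 10 * silverRatio := by
      rw [silverRatio]; linear_combination -hσ
    have hd : (1 + c)⁻¹ * (1 + c) = 1 := inv_mul_cancel₀ (by linarith)
    refine le_trans (le_of_eq ?_) (hb (by nlinarith) ?_ ?_)
    · rw [silverRatio]; ring
    · rw [← hm]; nlinarith
    · rw [← div_eq_mul_inv, le_div_iff₀ (by linarith), ← hm]; nlinarith

end Runs

/-! ### Smooth convex functions -/

section Smooth

variable {E : Type*} [NormedAddCommGroup E] [InnerProductSpace ℝ E] [CompleteSpace E]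
  {M : ℝ} {f : E → ℝ}

local notation "⟪" x ", " y "⟫" => inner ℝ x y

theorem IsSmoothConvex.hasDerivAt_line (hf : IsSmoothConvex M f) (x v : E) (t : ℝ) :
    HasDerivAt (fun t : ℝ => f (x + t • v)) ⟪gradient f (x + t • v), v⟫ t := by
  have h₁ := (hf.differentiable (x + t • v)).hasGradientAt.hasFDerivAt
  have h₂ : HasDerivAt (fun t : ℝ => x + t • v) v t := by
    simpa using ((hasDerivAt_id t).smul_const v).const_add x
  exact h₁.comp_hasDerivAt t h₂

theorem IsSmoothConvex.add_inner_le (hf : IsSmoothConvex M f) (x z : E) :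
    f x + ⟪gradient f x, z - x⟫ ≤ f z := by
  have hd := hf.hasDerivAt_line x (z - x) 0
  have hc : ConvexOn ℝ univ (fun t : ℝ => f (x + t • (z - x))) := by
    have e : (fun t : ℝ => f (x + t • (z - x))) = f ∘ (AffineMap.lineMap x z : ℝ →ᵃ[ℝ] E) := by
      ext t
      simp [AffineMap.lineMap_apply_module', add_comm]
    rw [e]
    exact hf.convex.comp_affineMap _
  have := hc.le_slope_of_hasDerivAt (mem_univ 0) (mem_univ 1) one_pos hd
  simp only [slope_def_field, zero_smul, add_zero, one_smul, add_sub_cancel, sub_zero,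
    div_one] at this
  linarith

/-- The descent lemma. -/
theorem IsSmoothConvex.le_add_inner_add (hf : IsSmoothConvex M f) (x z : E) :
    f z ≤ f x + ⟪gradient f x, z - x⟫ + M / 2 * ‖z - x‖ ^ 2 := by
  set v := z - x with hv
  have hd : ∀ t : ℝ, HasDerivAt (fun t : ℝ => f (x + t • v) - t * ⟪gradient f x, v⟫
      - M / 2 * ‖v‖ ^ 2 * t ^ 2)
      (⟪gradient f (x + t • v), v⟫ - ⟪gradient f x, v⟫ - M / 2 * ‖v‖ ^ 2 * (2 * t)) t := by
    intro t
    have h₁ := (hasDerivAt_id t).mul_const ⟪gradient f x, v⟫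
    have h₂ := (hasDerivAt_pow 2 t).const_mul (M / 2 * ‖v‖ ^ 2)
    exact (((hf.hasDerivAt_line x v t).sub h₁).sub h₂).congr_deriv (by norm_num)
  have ha := antitoneOn_of_deriv_nonpos (convex_Icc (0 : ℝ) 1)
    (fun t _ => (hd t).continuousAt.continuousWithinAt)
    (fun t _ => (hd t).differentiableAt.differentiableWithinAt) (fun t ht => by
      rw [interior_Icc] at ht
      rw [(hd t).deriv, ← inner_sub_left]
      have h₁ := real_inner_le_norm (gradient f (x + t • v) - gradient f x) v
      have h₂ := hf.lipschitz (x + t • v) x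
      rw [add_sub_cancel_left, norm_smul, Real.norm_eq_abs, abs_of_pos ht.1] at h₂
      have h₃ := mul_le_mul_of_nonneg_right h₂ (norm_nonneg v)
      linarith)
  have := ha (left_mem_Icc.2 zero_le_one) (right_mem_Icc.2 zero_le_one) zero_le_one
  simp only [hv, zero_smul, add_zero, one_smul, add_sub_cancel, zero_mul, one_mul, sub_zero,
    one_pow, mul_one, ne_eq, OfNat.ofNat_ne_zero, not_false_eq_true, zero_pow, mul_zero] at this
  linarith

/-- The interpolation inequality of convex `M`-smooth functions. -/
theorem IsSmoothConvex.interpolation (hM : 0 < M) (hf : IsSmoothConvex M f) (x y : E) :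
    f y + ⟪gradient f y, x - y⟫ + M⁻¹ / 2 * ‖gradient f x - gradient f y‖ ^ 2 ≤ f x := by
  set u := gradient f x - gradient f y with hu
  have h₁ := hf.add_inner_le y (x - M⁻¹ • u)
  have h₂ := hf.le_add_inner_add x (x - M⁻¹ • u)
  rw [sub_sub_cancel_left, inner_neg_right, norm_neg, norm_smul, real_inner_smul_right, mul_pow,
    Real.norm_eq_abs, sq_abs] at h₂
  rw [sub_right_comm, inner_sub_right, real_inner_smul_right] at h₁
  have h₃ : ⟪gradient f x, u⟫ - ⟪gradient f y, u⟫ = ‖u‖ ^ 2 := by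
    rw [← inner_sub_left, ← hu, real_inner_self_eq_norm_sq]
  have h₄ : M / 2 * (M⁻¹ ^ 2 * ‖u‖ ^ 2) = M⁻¹ / 2 * ‖u‖ ^ 2 := by field_simp
  have h₅ := congrArg (fun t => M⁻¹ * t) h₃
  rw [h₄] at h₂
  linarith

/-- Division by `M` and subtraction of a linear form make the gradient vanish at `p` and the
smoothness constant equal to `1`. -/
theorem IsSmoothConvex.isCocoercive (hM : 0 < M) (hf : IsSmoothConvex M f) (p : E) :
    IsCocoercive (fun x => M⁻¹ * f x - ⟪M⁻¹ • gradient f p, x⟫)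
      (fun x => M⁻¹ • (gradient f x - gradient f p)) := by
  intro x y
  have h := mul_le_mul_of_nonneg_left (hf.interpolation hM x y) (inv_nonneg.2 hM.le)
  rw [← smul_sub, sub_sub_sub_cancel_right, norm_smul, mul_pow, Real.norm_eq_abs, sq_abs]
  simp only [real_inner_smul_left, inner_sub_left, inner_sub_right] at h ⊢
  linarith

theorem silverStep_eq_div (M : ℝ) (t : ℕ) : silverStep M t = silverStep 1 t / M := by
  simp [silverStep]

theorem silverStep_pos (hM : 0 < M) (t : ℕ) : 0 < silverStep M t :=
  div_pos (add_pos (zpow_pos silverRatio_pos _) one_pos) hM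

variable {h : E → ℝ} {K : Set E} {x s : ℕ → E} {p : E} {n k : ℕ}

theorem IsSubgradientRun.normalize (hM : 0 < M)
    (hx : IsSubgradientRun (gradient f) h K (silverStep M) n x s) (p : E) :
    IsSubgradientRun (fun x => M⁻¹ • (gradient f x - gradient f p))
      (fun x => M⁻¹ * h x + ⟪M⁻¹ • gradient f p, x⟫) K (silverStep 1) n x
      (fun t => M⁻¹ • (s t + gradient f p)) := by
  intro t ht
  obtain ⟨hK, hs, e⟩ := hx t ht
  refine ⟨hK, fun z hz => ?_, ?_⟩
  · have := mul_le_mul_of_nonneg_left (hs z hz) (inv_nonneg.2 hM.le)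
    simp only [real_inner_smul_left, inner_add_left, inner_sub_right] at this ⊢
    linarith
  · rw [← smul_add, sub_add_add_cancel, smul_smul, ← div_eq_mul_inv, ← silverStep_eq_div]
    exact e

theorem one_lt_silverRatio : 1 < silverRatio := by linarith [silverRatio_bounds.1]

theorem two_pow_rpow_logb (k : ℕ) : ((2 : ℝ) ^ k) ^ Real.logb 2 silverRatio = silverRatio ^ k := by
  rw [← Real.rpow_natCast, ← Real.rpow_mul (by norm_num), mul_comm, Real.rpow_mul (by norm_num),
    Real.rpow_logb (by norm_num) (by norm_num) silverRatio_pos, Real.rpow_natCast]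

theorem logb_silverRatio_pos : 0 < Real.logb 2 silverRatio :=
  Real.logb_pos (by norm_num) one_lt_silverRatio

/-- The rate in terms of subgradients, for an arbitrary comparison point `p`. -/
theorem rate_of_subgradientRun (hM : 0 < M) (hf : IsSmoothConvex M f) (hp : p ∈ K) (hk : 1 ≤ k)
    (hn : n = 2 ^ k - 1)
    (hx : IsSubgradientRun (gradient f) h K (silverStep M) n x s) :
    f (x n) + h (x n) - (f p + h p) ≤ silverRate M ‖x 0 - p‖ n := by
  subst hn
  have hρ := silverRatio_pos
  have key := normalized_rate (hf.isCocoercive hM p) hp (by simp) hk (hx.normalize hM p)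
  generalize ‖x 0 - p‖ = D at *
  generalize x (2 ^ k - 1) = v at *
  have hN : (((2 ^ k - 1 : ℕ) : ℝ)) ^ Real.logb 2 silverRatio ≤ silverRatio ^ k := by
    rw [← two_pow_rpow_logb]
    refine Real.rpow_le_rpow (Nat.cast_nonneg _) ?_ logb_silverRatio_pos.le
    exact_mod_cast Nat.sub_le _ _
  have hN0 : 0 < (((2 ^ k - 1 : ℕ) : ℝ)) ^ Real.logb 2 silverRatio := by
    refine Real.rpow_pos_of_pos ?_ _
    have : 2 ^ 1 ≤ 2 ^ k := Nat.pow_le_pow_right (by norm_num) hk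
    exact_mod_cast (by omega : 0 < 2 ^ k - 1)
  calc f v + h v - (f p + h p)
      = silverRatio / (4 * √2 * silverRatio ^ k) * (M * (4 * √2 * (silverRatio ^ k / silverRatio) *
        (M⁻¹ * f v - ⟪M⁻¹ • gradient f p, v⟫ + (M⁻¹ * h v + ⟪M⁻¹ • gradient f p, v⟫)
        - (M⁻¹ * f p - ⟪M⁻¹ • gradient f p, p⟫ + (M⁻¹ * h p + ⟪M⁻¹ • gradient f p, p⟫))))) := by
        field_simp
        ring
    _ ≤ silverRatio / (4 * √2 * silverRatio ^ k) * (M * D ^ 2) := by gcongr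
    _ ≤ silverRate M D (2 ^ k - 1) := by
        unfold silverRate
        gcongr

end Smooth

/-! ### Proximal, projection and soft-thresholding steps -/

section Prox

variable {E : Type*} [NormedAddCommGroup E] [InnerProductSpace ℝ E]

local notation "⟪" x ", " y "⟫" => inner ℝ x y

/-- The optimality condition of the proximal step, for a real-valued convex function on `K`. -/
theorem isSubgradientOn_of_prox {h : E → ℝ} {K : Set E} (hh : ConvexOn ℝ K h) {a : ℝ} (ha : 0 < a)
    {y z : E} (hz : z ∈ K)
    (hmin : ∀ w ∈ K, h z + 1 / (2 * a) * ‖z - y‖ ^ 2 ≤ h w + 1 / (2 * a) * ‖w - y‖ ^ 2) :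
    IsSubgradientOn h K z (a⁻¹ • (y - z)) := by
  intro w hw
  have key : ∀ t : ℝ, 0 < t → t ≤ 1 →
      h z + ⟪a⁻¹ • (y - z), w - z⟫ - h w ≤ t * (1 / (2 * a) * ‖w - z‖ ^ 2) := by
    intro t ht ht1
    have h₁ := hmin _ (hh.1 hz hw (sub_nonneg.2 ht1) ht.le (sub_add_cancel _ _))
    have h₂ := hh.2 hz hw (sub_nonneg.2 ht1) ht.le (sub_add_cancel _ _)
    have e : (1 - t) • z + t • w - y = (z - y) + t • (w - z) := by module
    rw [e, norm_add_sq_real, norm_smul, mul_pow, Real.norm_eq_abs, sq_abs,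
      real_inner_smul_right] at h₁
    simp only [smul_eq_mul] at h₂
    rw [real_inner_smul_left, ← neg_sub z y, inner_neg_left]
    have h₃ : 1 / (2 * a) * (2 * (t * ⟪z - y, w - z⟫)) = t * (a⁻¹ * ⟪z - y, w - z⟫) := by
      field_simp
    refine le_of_mul_le_mul_left ?_ ht
    linarith
  by_contra! hlt
  obtain ⟨t, ht, ht1⟩ : ∃ t : ℝ, 0 < t ∧ t ≤ 1 ∧ t * (1 / (2 * a) * ‖w - z‖ ^ 2) <
      h z + ⟪a⁻¹ • (y - z), w - z⟫ - h w := by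
    set B := 1 / (2 * a) * ‖w - z‖ ^ 2
    have hB : 0 ≤ B := by positivity
    set A := h z + ⟪a⁻¹ • (y - z), w - z⟫ - h w
    have hA : 0 < A := by simp only [A]; linarith
    refine ⟨A / (A + B), by positivity, div_le_one_of_le₀ (by linarith) (by positivity), ?_⟩
    rw [div_mul_eq_mul_div, div_lt_iff₀ (by positivity)]
    nlinarith
  linarith [key t ht ht1.1, ht1.2]

theorem IsProperConvex.convexOn_toReal {h : E → EReal} (hh : IsProperConvex h) :
    ConvexOn ℝ {x | h x ≠ ⊤} (fun x => (h x).toReal) := by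
  have coe : ∀ x, h x ≠ ⊤ → ((h x).toReal : EReal) = h x := fun x hx =>
    EReal.coe_toReal hx (hh.ne_bot x)
  have key : ∀ x, h x ≠ ⊤ → ∀ y, h y ≠ ⊤ → ∀ a b : ℝ, 0 ≤ a → 0 ≤ b → a + b = 1 →
      h (a • x + b • y) ≤ ((a * (h x).toReal + b * (h y).toReal : ℝ) : EReal) := by
    intro x hx y hy a b ha hb hab
    have hx' : (x, (h x).toReal) ∈ {p : E × ℝ | h p.1 ≤ (p.2 : EReal)} := (coe x hx).ge
    have hy' : (y, (h y).toReal) ∈ {p : E × ℝ | h p.1 ≤ (p.2 : EReal)} := (coe y hy).ge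
    exact hh.convex_epigraph hx' hy' ha hb hab
  have hK : Convex ℝ {x | h x ≠ ⊤} := fun x hx y hy a b ha hb hab =>
    ((key x hx y hy a b ha hb hab).trans_lt (EReal.coe_lt_top _)).ne
  refine ⟨hK, fun x hx y hy a b ha hb hab => ?_⟩
  have := key x hx y hy a b ha hb hab
  rw [← coe _ (hK hx hy ha hb hab)] at this
  exact_mod_cast this

theorem IsProx.ne_top {h : E → EReal} (hh : IsProperConvex h) {a : ℝ} {y z : E}
    (hz : IsProx a h y z) : h z ≠ ⊤ := by
  obtain ⟨w, hw⟩ := hh.exists_ne_top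
  intro htop
  have := hz (mem_univ w)
  simp only [mem_ofPred_eq, htop] at this
  rw [EReal.top_add_coe, top_le_iff, ← EReal.coe_toReal hw (hh.ne_bot w)] at this
  exact EReal.coe_ne_top _ (by exact_mod_cast this)

theorem IsProx.isSubgradientOn {h : E → EReal} (hh : IsProperConvex h) {a : ℝ} (ha : 0 < a)
    {y z : E} (hz : IsProx a h y z) :
    IsSubgradientOn (fun x => (h x).toReal) {x | h x ≠ ⊤} z (a⁻¹ • (y - z)) := by
  refine isSubgradientOn_of_prox hh.convexOn_toReal ha (hz.ne_top hh) fun w hw => ?_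
  have := hz (mem_univ w)
  simp only [mem_ofPred_eq] at this
  rw [← EReal.coe_toReal hw (hh.ne_bot w),
    ← EReal.coe_toReal (hz.ne_top hh) (hh.ne_bot z)] at this
  exact_mod_cast this

/-- A run of implicit steps `x (t + 1) ∈ x t - α t • (g (x t) + ∂h (x (t + 1)))`. -/
theorem IsSubgradientRun.of_step {g : E → E} {h : E → ℝ} {K : Set E} {α : ℕ → ℝ} {n : ℕ}
    {x : ℕ → E} (hα : ∀ t, 0 < α t)
    (hx : ∀ t < n, x (t + 1) ∈ K ∧
      IsSubgradientOn h K (x (t + 1)) ((α t)⁻¹ • (x t - α t • g (x t) - x (t + 1)))) :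
    IsSubgradientRun g h K α n x
      (fun t => (α (t - 1))⁻¹ • (x (t - 1) - α (t - 1) • g (x (t - 1)) - x t)) := by
  intro t ht
  refine ⟨(hx t ht).1, (hx t ht).2, ?_⟩
  simp only [Nat.add_sub_cancel, smul_add, smul_inv_smul₀ (hα t).ne']
  abel

end Prox

section Instances

variable {E : Type*} [NormedAddCommGroup E] [InnerProductSpace ℝ E] [CompleteSpace E]
  {M : ℝ} {f : E → ℝ} {x : ℕ → E} {xs : E} {n k : ℕ}

theorem SilverProxGD.rate {h : E → EReal} (H : SilverProxGD M f h n x xs) (hk : 1 ≤ k)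
    (hn : n = 2 ^ k - 1) :
    objective f h (x n) - objective f h xs ≤ (silverRate M ‖x 0 - xs‖ n : EReal) := by
  have hp := H.proper
  have hxs : h xs ≠ ⊤ := by
    obtain ⟨w, hw⟩ := hp.exists_ne_top
    intro htop
    have := H.minimizer (mem_univ w)
    simp only [mem_ofPred_eq, objective, htop] at this
    rw [EReal.coe_add_top, top_le_iff, ← EReal.coe_toReal hw (hp.ne_bot w)] at this
    exact EReal.coe_ne_top _ (by exact_mod_cast this)
  have hrun := IsSubgradientRun.of_step (silverStep_pos H.pos)
    fun t ht => ⟨(H.run t ht).ne_top hp, (H.run t ht).isSubgradientOn hp (silverStep_pos H.pos t)⟩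
  have hr := rate_of_subgradientRun H.pos H.smooth hxs hk hn hrun
  have hn1 : n - 1 + 1 = n := by
    have : 2 ^ 1 ≤ 2 ^ k := Nat.pow_le_pow_right (by norm_num) hk
    omega
  have hxn : h (x n) ≠ ⊤ := hn1 ▸ (H.run (n - 1) (by omega)).ne_top hp
  rw [objective, objective, ← EReal.coe_toReal hxs (hp.ne_bot _),
    ← EReal.coe_toReal hxn (hp.ne_bot _)]
  exact_mod_cast hr

theorem SilverProjGD.rate {K : Set E} (H : SilverProjGD M f K n x xs) (hk : 1 ≤ k)
    (hn : n = 2 ^ k - 1) : f (x n) - f xs ≤ silverRate M ‖x 0 - xs‖ n := by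
  have hrun := IsSubgradientRun.of_step (g := gradient f) (h := fun _ => 0) (K := K) (x := x)
    (silverStep_pos H.pos) fun t ht =>
      ⟨(H.run t ht).1, isSubgradientOn_of_prox (convexOn_const 0 H.convex)
        (silverStep_pos H.pos t) (H.run t ht).1 fun w hw => by
          have h₁ := (H.run t ht).2 hw
          have h₂ := silverStep_pos H.pos t
          simp only [mem_ofPred_eq] at h₁
          gcongr⟩
  simpa using rate_of_subgradientRun H.pos H.smooth H.mem hk hn hrun

end Instances

section SoftThreshold

/-- Soft thresholding selects a subgradient of `a |·|`. -/
theorem abs_softThreshold_add_le {a : ℝ} (ha : 0 ≤ a) (y w : ℝ) :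
    a * |Real.sign y * max (|y| - a) 0| + (y - Real.sign y * max (|y| - a) 0) *
      (w - Real.sign y * max (|y| - a) 0) ≤ a * |w| := by
  have hw₁ := mul_le_mul_of_nonneg_left (le_abs_self w) ha
  have hw₂ := mul_le_mul_of_nonneg_left (neg_le_abs w) ha
  rcases le_total (|y|) a with hy | hy
  · rw [max_eq_right (by linarith), mul_zero, abs_zero, mul_zero, sub_zero, sub_zero, zero_add]
    calc y * w ≤ |y * w| := le_abs_self _
      _ = |y| * |w| := abs_mul _ _
      _ ≤ a * |w| := by gcongr
  · rw [max_eq_left (by linarith)]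
    rcases lt_trichotomy y 0 with h0 | rfl | h0
    · rw [Real.sign_of_neg h0, abs_of_neg h0] at *
      rw [abs_of_nonpos (by linarith)]
      linarith
    · simp at hy
      simp [le_antisymm hy ha]
    · rw [Real.sign_of_pos h0, abs_of_pos h0] at *
      rw [abs_of_nonneg (by linarith)]
      linarith

variable {d : ℕ}

theorem isSubgradientOn_softThreshold {a l : ℝ} (ha : 0 < a) (hl : 0 ≤ l)
    (y : EuclideanSpace ℝ (Fin d)) :
    IsSubgradientOn (fun w => l * l1Norm w) univ (softThreshold (a * l) y)
      (a⁻¹ • (y - softThreshold (a * l) y)) := by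
  intro w _
  refine le_of_mul_le_mul_left ?_ ha
  rw [real_inner_smul_left, mul_add, mul_inv_cancel_left₀ ha.ne', ← mul_assoc, ← mul_assoc,
    PiLp.inner_apply, l1Norm, l1Norm, Finset.mul_sum, Finset.mul_sum, ← Finset.sum_add_distrib]
  refine Finset.sum_le_sum fun i _ => ?_
  have := abs_softThreshold_add_le (mul_nonneg ha.le hl) (y i) (w i)
  simpa [softThreshold, mul_comm] using this

theorem SilverISTA.rate {M : ℝ} {f : EuclideanSpace ℝ (Fin d) → ℝ} {l : ℝ} {n k : ℕ}
    {x : ℕ → EuclideanSpace ℝ (Fin d)} {xs : EuclideanSpace ℝ (Fin d)}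
    (H : SilverISTA M f l n x xs) (hk : 1 ≤ k) (hn : n = 2 ^ k - 1) :
    f (x n) + l * l1Norm (x n) - (f xs + l * l1Norm xs) ≤ silverRate M ‖x 0 - xs‖ n := by
  have hrun := IsSubgradientRun.of_step (g := gradient f) (h := fun w => l * l1Norm w) (K := univ)
    (x := x) (silverStep_pos H.pos) fun t ht => ⟨mem_univ _, by
      rw [H.run t ht]
      exact isSubgradientOn_softThreshold (silverStep_pos H.pos t) H.nonneg _⟩
  exact rate_of_subgradientRun H.pos H.smooth (mem_univ _) hk hn hrun

end SoftThreshold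

/-! ### Iteration complexity -/

theorem silverRate_mono {M D D' : ℝ} (hM : 0 ≤ M) (hD : 0 ≤ D) (h : D ≤ D') (n : ℕ) :
    silverRate M D n ≤ silverRate M D' n := by
  have := silverRatio_pos
  unfold silverRate
  gcongr

/-- With `A = M * D ^ 2 / ε`, the horizon `2 ^ (m + 1) - 1` suffices as soon as `A ≤ ρ ^ m`. -/
theorem silverRate_le {M D ε : ℝ} (hM : 0 < M) (hε : 0 < ε) {m : ℕ}
    (hm : M * D ^ 2 / ε ≤ silverRatio ^ m) : silverRate M D (2 ^ (m + 1) - 1) ≤ ε := by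
  have hρ := silverRatio_pos
  have hN : silverRatio ^ m ≤ (((2 ^ (m + 1) - 1 : ℕ) : ℝ)) ^ Real.logb 2 silverRatio := by
    rw [← two_pow_rpow_logb]
    refine Real.rpow_le_rpow (by positivity) ?_ logb_silverRatio_pos.le
    have : 1 ≤ 2 ^ m := Nat.one_le_two_pow
    exact_mod_cast (by omega : 2 ^ m ≤ 2 ^ (m + 1) - 1)
  have hc : silverRatio ≤ 4 * √2 := by unfold silverRatio; linarith [sqrt_two_bounds.1]
  have h2 : 0 < √(2 : ℝ) := by positivity
  calc silverRate M D (2 ^ (m + 1) - 1)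
      ≤ silverRatio / (4 * √2 * silverRatio ^ m) * (M * D ^ 2) := by
        unfold silverRate
        gcongr
    _ = silverRatio / (4 * √2) * (M * D ^ 2 / silverRatio ^ m) := by field_simp
    _ ≤ 1 * (M * D ^ 2 / silverRatio ^ m) := by
        gcongr
        exact div_le_one_of_le₀ hc (by positivity)
    _ ≤ ε := by
        rw [one_mul, div_le_iff₀ (by positivity), mul_comm ε]
        exact (div_le_iff₀ hε).1 hm

theorem exists_horizon {M D ε : ℝ} (hM : 0 < M) (hε : 0 < ε) :
    ∃ k n : ℕ, 1 ≤ k ∧ n = 2 ^ k - 1 ∧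
      (n : ℝ) ≤ max 1 (4 * (M * D ^ 2 / ε) ^ Real.logb silverRatio 2) ∧ silverRate M D n ≤ ε := by
  rcases lt_or_ge (M * D ^ 2 / ε) 1 with hA | hA
  · exact ⟨1, 1, le_rfl, rfl, by simp, silverRate_le hM hε (m := 0) (by simpa using hA.le)⟩
  · obtain ⟨m, h₁, h₂⟩ := exists_nat_pow_near hA one_lt_silverRatio
    refine ⟨m + 2, 2 ^ (m + 2) - 1, by omega, rfl, le_max_of_le_right ?_,
      silverRate_le hM hε h₂.le⟩
    have h₃ : (2 : ℝ) ^ m ≤ (M * D ^ 2 / ε) ^ Real.logb silverRatio 2 := by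
      have hρ := silverRatio_pos
      calc (2 : ℝ) ^ m = (silverRatio ^ m) ^ Real.logb silverRatio 2 := by
            rw [← Real.rpow_natCast silverRatio, ← Real.rpow_mul hρ.le, mul_comm,
              Real.rpow_mul hρ.le, Real.rpow_logb hρ one_lt_silverRatio.ne' (by norm_num),
              Real.rpow_natCast]
        _ ≤ _ := Real.rpow_le_rpow (by positivity) h₁
            (Real.logb_pos one_lt_silverRatio (by norm_num)).le
    have h₄ : (((2 ^ (m + 2) - 1 : ℕ)) : ℝ) ≤ 2 ^ (m + 2) := by exact_mod_cast Nat.sub_le _ _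
    calc _ ≤ _ := h₄
      _ = 4 * 2 ^ m := by ring
      _ ≤ _ := by gcongr

theorem theorem1 :
    -- convergence rate at every horizon `n = 2 ^ k - 1`: proximal GD, projected GD, ISTA
    (∀ (d k n : ℕ) (M : ℝ) (f : EuclideanSpace ℝ (Fin d) → ℝ)
        (x : ℕ → EuclideanSpace ℝ (Fin d)) (xs : EuclideanSpace ℝ (Fin d)),
      1 ≤ k → n = 2 ^ k - 1 →
        (∀ h : EuclideanSpace ℝ (Fin d) → EReal, SilverProxGD M f h n x xs →
          objective f h (x n) - objective f h xs ≤ (silverRate M ‖x 0 - xs‖ n : EReal)) ∧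
        (∀ K : Set (EuclideanSpace ℝ (Fin d)), SilverProjGD M f K n x xs →
          f (x n) - f xs ≤ silverRate M ‖x 0 - xs‖ n) ∧
        (∀ l : ℝ, SilverISTA M f l n x xs →
          (f (x n) + l * l1Norm (x n)) - (f xs + l * l1Norm xs) ≤
            silverRate M ‖x 0 - xs‖ n)) ∧
    -- iteration complexity, with an absolute constant `C`, and with a number of iterations `n`
    -- that depends only on `M`, `ε` and (an upper bound `D` on) the initial distance
    (∃ C : ℝ, 0 < C ∧ ∀ M D ε : ℝ, 0 < M → 0 ≤ D → 0 < ε →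
      ∃ k n : ℕ, 1 ≤ k ∧ n = 2 ^ k - 1 ∧
        (n : ℝ) ≤ max 1 (C * (M * D ^ 2 / ε) ^ Real.logb silverRatio 2) ∧
        ∀ (d : ℕ) (f : EuclideanSpace ℝ (Fin d) → ℝ)
          (x : ℕ → EuclideanSpace ℝ (Fin d)) (xs : EuclideanSpace ℝ (Fin d)),
          ‖x 0 - xs‖ ≤ D →
            (∀ h : EuclideanSpace ℝ (Fin d) → EReal, SilverProxGD M f h n x xs →
              objective f h (x n) - objective f h xs ≤ (ε : EReal)) ∧
            (∀ K : Set (EuclideanSpace ℝ (Fin d)), SilverProjGD M f K n x xs →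
              f (x n) - f xs ≤ ε) ∧
            (∀ l : ℝ, SilverISTA M f l n x xs →
              (f (x n) + l * l1Norm (x n)) - (f xs + l * l1Norm xs) ≤ ε)) := by
  refine ⟨fun d k n M f x xs hk hn =>
    ⟨fun h H => H.rate hk hn, fun K H => H.rate hk hn, fun l H => H.rate hk hn⟩,
    4, by norm_num, fun M D ε hM hD hε => ?_⟩
  obtain ⟨k, n, hk, hn, hnC, hr⟩ := exists_horizon (D := D) hM hε
  refine ⟨k, n, hk, hn, hnC, fun d f x xs hx => ?_⟩
  have hle := (silverRate_mono hM.le (norm_nonneg _) hx n).trans hr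
  exact ⟨fun h H => (H.rate hk hn).trans (EReal.coe_le_coe_iff.2 hle),
    fun K H => (H.rate hk hn).trans hle, fun l H => (H.rate hk hn).trans hle⟩
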